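/- Let $n\ge 2$. All manifolds are smooth, Hausdorff, second countable and of dimension $n+1$. A \emph{continuous} (respectively \emph{smooth}) spacetime is such a manifold with a Lorentzian metric of signature $(-,+,\dots,+)$ whose components in all coordinates are continuous (respectively smooth), time oriented by a continuous timelike vector field. A \emph{future directed timelike curve} is a Lipschitz curve $\gamma\colon[a,b]\to M_{\rm ext}$, $a<b$, such that, for some $\varepsilon>0$, $\gamma'$ is future directed timelike with $g_{\rm ext}(\gamma',\gamma')<-\varepsilon$ almost everywhere; a \emph{future directed causal curve} is a Lipschitz curve with $\gamma'$ future directed causal (nonzero) almost everywhere. $I^+(p,U)$ and $J^+(p,U)$ are the sets of endpoints of such timelike, respectively causal, curves that start at $p$ and lie in $U$; moreover $p\in J^+(p,U)$ for $p\in U$. Let $(M_{\rm ext},g_{\rm ext})$ be a continuous extension of a smooth spacetime $(M,g)$, that is, a continuous spacetime of the same dimension in which $M$ is a proper open subset with $g=g_{\rm ext}|_M$ and the restricted time orientation. Let $\partial^-M$ be the set of all $p\in\overline M\setminus M$ for which there is a future directed timelike curve $\gamma\colon[a,b]\to M_{\rm ext}$ with $\gamma(a)=p$ and $\gamma((a,b])\subset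 M$. Suppose that $M=I^+(\mathcal O,M_{\rm ext})$ for some $\mathcal O\in\partial^-M$. A function on $M$ \emph{extends continuously} to $M\cup\{\mathcal O\}$ if it is the restriction of a continuous function on $M\cup\{\mathcal O\}$ (with the subspace topology); a tensor field on $M$ extends continuously if its components in some coordinates around $\mathcal O$ do. Assume: (a) $(M,g)$ solves the Einstein equations with a perfect fluid $(u,\rho,p)$: $u$ is a smooth future directed timelike vector field on $M$ with $g(u,u)=-1$, $\rho$ and $p$ are smooth functions on $M$, and, with $u_*=g(u,\cdot)$, $$\mathrm{Ric}-\tfrac12 R\,g=8\pi\big[(\rho+p)\,u_*\otimes u_*+p\,g\big]\quad\text{on } M.$$ (b) Every (maximal) integral curve of $u$ in $M$ has past endpoint $\mathcal O$ in $M_{\rm ext}$, i.e. it converges to $\mathcal O$ as its parameter decreases to the lower end of its domain; and every continuous curve $\gamma\colon[a,b]\to M\cup\{\mathcal O\}$ with $\gamma(a)=\mathcal O$ that is an integral curve of $u$ in $M$ on $(a,b]$ is a future directed timelike curve in $M_{\rm ext}$. (c) The Ricci tensor $\mathrm{Ric}$ of $(M,g)$, $\rho$ and $p$ extend continuously to $M\cup\{\mathcal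 O\}$. Assume moreover at least one of the following: (d) $(M_{\rm ext},g_{\rm ext})$ is strongly causal at $\mathcal O$: every neighborhood $U$ of $\mathcal O$ contains a neighborhood $V$ of $\mathcal O$ such that every future directed causal curve with both endpoints in $V$ lies in $U$. (d$'$) Every neighborhood $U$ of $\mathcal O$ contains a neighborhood $V$ of $\mathcal O$ such that $\partial^-M\cap V\subset J^+(\mathcal O,V)$. Then the scalar curvature $R$ of $(M,g)$ extends continuously to $M\cup\{\mathcal O\}$, and the continuous extensions $\widetilde R$ and $\widetilde\rho$ of $R$ and $\rho$ satisfy $$\widetilde R(\mathcal O)=16\pi\,\frac{n+1}{n-1}\,\widetilde\rho(\mathcal O).$$ In particular, if the spacetime dimension is $n+1=4$, then $\widetilde R(\mathcal O)=32\pi\,\widetilde\rho(\mathcal O)$. -/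

import Mathlib

open Set Filter MeasureTheory
open scoped Manifold ContDiff Topology

noncomputable section

namespace C0Spacetime

/-- The coordinate space `ℝⁿ⁺¹`. -/
abbrev Coord (n : ℕ) : Type := EuclideanSpace ℝ (Fin (n + 1))

/-- The `i`-th standard unit vector of `ℝⁿ⁺¹`. -/
def stdVec (n : ℕ) (i : Fin (n + 1)) : Coord n := EuclideanSpace.single i (1 : ℝ)

variable {n : ℕ} {N : Type*} [TopologicalSpace N] [ChartedSpace (Coord n) N]

/-- A (not necessarily continuous) vector field on an `(n+1)`-dimensional manifold. -/
abbrev VecField (n : ℕ) (N : Type*) [TopologicalSpace N] [ChartedSpace (Coord n) N] : Type _ :=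
  (x : N) → TangentSpace (𝓡 (n + 1)) x

/-- A (not necessarily continuous) covariant 2-tensor field on an `(n+1)`-dimensional manifold. -/
abbrev Tensor2 (n : ℕ) (N : Type*) [TopologicalSpace N] [ChartedSpace (Coord n) N] : Type _ :=
  (x : N) → LinearMap.BilinForm ℝ (TangentSpace (𝓡 (n + 1)) x)

/-- The charts (coordinate systems) of the smooth structure of `N`. -/
abbrev IsSmoothChart (e : OpenPartialHomeomorph N (Coord n)) : Prop :=
  e ∈ IsManifold.maximalAtlas (𝓡 (n + 1)) ∞ N

/-! ### Components in coordinates -/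

/-- The coordinate vector `∂ᵢ` of the chart `e`, at the point with coordinates `y`. -/
def coordVec (e : OpenPartialHomeomorph N (Coord n)) (i : Fin (n + 1)) (y : Coord n) :
    TangentSpace (𝓡 (n + 1)) (e.symm y) :=
  mfderiv (𝓡 (n + 1)) (𝓡 (n + 1)) e.symm y (stdVec n i)

/-- The differential `dxⁱ` of the `i`-th coordinate function of the chart `e`, at `x`. -/
def coordCovec (e : OpenPartialHomeomorph N (Coord n)) (i : Fin (n + 1)) (x : N) :
    TangentSpace (𝓡 (n + 1)) x →ₗ[ℝ] ℝ :=
  (EuclideanSpace.proj i : Coord n →L[ℝ] ℝ).toLinearMap ∘ₗ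
    (mfderiv (𝓡 (n + 1)) (𝓡 (n + 1)) e x).toLinearMap

/-- The component `Tᵢⱼ = T(∂ᵢ, ∂ⱼ)` in the chart `e`, as a function of the coordinates `y`. -/
def comp (T : Tensor2 n N) (e : OpenPartialHomeomorph N (Coord n)) (i j : Fin (n + 1))
    (y : Coord n) : ℝ :=
  T (e.symm y) (coordVec e i y) (coordVec e j y)

/-- The matrix of all components in the chart `e`. -/
def compMatrix (T : Tensor2 n N) (e : OpenPartialHomeomorph N (Coord n)) (y : Coord n) :
    Matrix (Fin (n + 1)) (Fin (n + 1)) ℝ :=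
  Matrix.of fun i j => comp T e i j y

/-! ### Curvature -/

/-- The partial derivative `∂ᵢ f` of a function of the coordinates. -/
def pderiv (i : Fin (n + 1)) (f : Coord n → ℝ) (y : Coord n) : ℝ :=
  fderiv ℝ f y (stdVec n i)

/-- The Christoffel symbol `Γᵏᵢⱼ` of `g` in the chart `e`. -/
def christoffel (g : Tensor2 n N) (e : OpenPartialHomeomorph N (Coord n))
    (k i j : Fin (n + 1)) (y : Coord n) : ℝ :=
  (1 / 2) * ∑ l, (compMatrix g e y)⁻¹ k l *
    (pderiv i (comp g e j l) y + pderiv j (comp g e i l) y - pderiv l (comp g e i j) y)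

/-- The component `Rᵢⱼ` of the Ricci tensor of `g` in the chart `e`:
`Rᵢⱼ = ∂ₖΓᵏᵢⱼ - ∂ⱼΓᵏᵢₖ + ΓᵏₖₗΓˡᵢⱼ - ΓᵏⱼₗΓˡᵢₖ` (summed over `k` and `l`). -/
def ricciComp (g : Tensor2 n N) (e : OpenPartialHomeomorph N (Coord n))
    (i j : Fin (n + 1)) (y : Coord n) : ℝ :=
  ∑ k, (pderiv k (christoffel g e k i j) y - pderiv j (christoffel g e k i k) y) +
    ∑ k, ∑ l, (christoffel g e k k l y * christoffel g e l i j y -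
      christoffel g e k j l y * christoffel g e l i k y)

/-- The Ricci tensor `Ric = Rᵢⱼ dxⁱ ⊗ dxʲ`, computed at `x` in the preferred chart at `x`
(any other smooth chart around `x` gives the same bilinear form). -/
def ricci (g : Tensor2 n N) : Tensor2 n N := fun x =>
  ∑ i, ∑ j, ricciComp g (chartAt (Coord n) x) i j (chartAt (Coord n) x x) •
    LinearMap.BilinForm.linMulLin (coordCovec (chartAt (Coord n) x) i x)
      (coordCovec (chartAt (Coord n) x) j x)

/-- The scalar curvature `R = gⁱʲ Ric(∂ᵢ, ∂ⱼ)`, computed at `x` in the preferred chart at `x`. -/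
def scalarCurvature (g : Tensor2 n N) (x : N) : ℝ :=
  ∑ i, ∑ j, (compMatrix g (chartAt (Coord n) x) (chartAt (Coord n) x x))⁻¹ i j *
    comp (ricci g) (chartAt (Coord n) x) i j (chartAt (Coord n) x x)

/-! ### Spacetimes -/

/-- `b` is a symmetric bilinear form of signature `(-, +, …, +)`: it has an orthonormal basis. -/
def IsLorentzForm {V : Type*} [AddCommGroup V] [Module ℝ V] (n : ℕ)
    (b : LinearMap.BilinForm ℝ V) : Prop :=
  ∃ e : Module.Basis (Fin (n + 1)) ℝ V,
    ∀ i j, b (e i) (e j) = if i = j then (if i = 0 then -1 else 1) else 0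

/-- `(N, g)` is a continuous spacetime: `g` is a Lorentzian metric with continuous components in
all coordinates, time oriented by the continuous timelike vector field `X`. -/
structure IsContinuousSpacetime [IsManifold (𝓡 (n + 1)) ∞ N] (g : Tensor2 n N)
    (X : VecField n N) : Prop where
  lorentz : ∀ x, IsLorentzForm n (g x)
  continuous_metric : ∀ e : OpenPartialHomeomorph N (Coord n), IsSmoothChart e →
    ∀ i j, ContinuousOn (comp g e i j) e.target
  continuous_orientation :
    Continuous fun x => (⟨x, X x⟩ : TangentBundle (𝓡 (n + 1)) N)
  timelike_orientation : ∀ x, g x (X x) (X x) < 0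

/-- The components of `g` in all coordinates are smooth on the open set `M`. -/
def IsSmoothMetricOn (g : Tensor2 n N) (M : Set N) : Prop :=
  ∀ e : OpenPartialHomeomorph N (Coord n), IsSmoothChart e →
    ∀ i j, ContDiffOn ℝ ∞ (comp g e i j) (e.target ∩ e.symm ⁻¹' M)

/-- `(N, g)` with the time orientation `X` is a continuous extension of the smooth spacetime
`(M, g|_M)`. The smaller spacetime is identified with its image, which is an open subset because
the dimensions agree, and carries the restrictions of the metric and of the time orientation. -/
structure IsContinuousExtension [IsManifold (𝓡 (n + 1)) ∞ N] (g : Tensor2 n N)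
    (X : VecField n N) (M : Set N) : Prop where
  spacetime : IsContinuousSpacetime g X
  isOpen : IsOpen M
  nonempty : M.Nonempty
  proper : M ≠ univ
  smooth : IsSmoothMetricOn g M

/-! ### Causality -/

/-- `v` is a future directed timelike vector. -/
def IsFutureTimelike (g : Tensor2 n N) (X : VecField n N) (x : N)
    (v : TangentSpace (𝓡 (n + 1)) x) : Prop :=
  g x v v < 0 ∧ g x (X x) v < 0

/-- `v` is a future directed causal (timelike or null, nonzero) vector. -/
def IsFutureCausal (g : Tensor2 n N) (X : VecField n N) (x : N)
    (v : TangentSpace (𝓡 (n + 1)) x) : Prop :=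
  v ≠ 0 ∧ g x v v ≤ 0 ∧ g x (X x) v < 0

/-- The velocity `γ'(t)` (zero where `γ` is not differentiable). -/
def velocity (γ : ℝ → N) (t : ℝ) : TangentSpace (𝓡 (n + 1)) (γ t) :=
  mfderiv 𝓘(ℝ, ℝ) (𝓡 (n + 1)) γ t (1 : ℝ)

/-- `γ : [a, b] → N` is a Lipschitz curve (only the values of `γ` on `[a, b]` matter): it is
continuous, and near each parameter it is Lipschitz in the coordinates. -/
def IsLipschitzCurve (n : ℕ) {N : Type*} [TopologicalSpace N] [ChartedSpace (Coord n) N]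
    (γ : ℝ → N) (a b : ℝ) : Prop :=
  ContinuousOn γ (Icc a b) ∧
    ∀ t ∈ Icc a b, ∃ K, ∃ s ∈ 𝓝[Icc a b] t, LipschitzOnWith K (chartAt (Coord n) (γ t) ∘ γ) s

/-- `γ : [a, b] → N` is a future directed timelike curve. -/
def IsTimelikeCurve (g : Tensor2 n N) (X : VecField n N) (γ : ℝ → N) (a b : ℝ) : Prop :=
  a < b ∧ IsLipschitzCurve n γ a b ∧ ∃ ε > 0, ∀ᵐ t ∂volume.restrict (Ioo a b),
    IsFutureTimelike g X (γ t) (velocity γ t) ∧ g (γ t) (velocity γ t) (velocity γ t) < -ε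

/-- `γ : [a, b] → N` is a future directed causal curve. -/
def IsCausalCurve (g : Tensor2 n N) (X : VecField n N) (γ : ℝ → N) (a b : ℝ) : Prop :=
  a < b ∧ IsLipschitzCurve n γ a b ∧ ∀ᵐ t ∂volume.restrict (Ioo a b),
    IsFutureCausal g X (γ t) (velocity γ t)

/-- The timelike future `I⁺(p, U)`. -/
def timelikeFuture (g : Tensor2 n N) (X : VecField n N) (p : N) (U : Set N) : Set N :=
  {q | ∃ (γ : ℝ → N) (a b : ℝ), IsTimelikeCurve g X γ a b ∧ MapsTo γ (Icc a b) U ∧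
    γ a = p ∧ γ b = q}

/-- The causal future `J⁺(p, U)`; it contains `p` itself. -/
def causalFuture (g : Tensor2 n N) (X : VecField n N) (p : N) (U : Set N) : Set N :=
  {q | (q = p ∧ p ∈ U) ∨ ∃ (γ : ℝ → N) (a b : ℝ), IsCausalCurve g X γ a b ∧
    MapsTo γ (Icc a b) U ∧ γ a = p ∧ γ b = q}

/-- The past boundary `∂⁻M`: the points of `∂M = closure M \ M` from which some future directed
timelike curve starts that lies in `M` afterwards. -/
def pastBoundary (g : Tensor2 n N) (X : VecField n N) (M : Set N) : Set N :=
  {p | p ∈ closure M \ M ∧ ∃ (γ : ℝ → N) (a b : ℝ), IsTimelikeCurve g X γ a b ∧ γ a = p ∧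
    MapsTo γ (Ioc a b) M}

/-- The spacetime is strongly causal at `O`. -/
def IsStronglyCausalAt (g : Tensor2 n N) (X : VecField n N) (O : N) : Prop :=
  ∀ U ∈ 𝓝 O, ∃ V ∈ 𝓝 O, V ⊆ U ∧ ∀ (γ : ℝ → N) (a b : ℝ), IsCausalCurve g X γ a b →
    γ a ∈ V → γ b ∈ V → MapsTo γ (Icc a b) U

/-- Every neighborhood of `O` contains a neighborhood `V` of `O` with `∂⁻M ∩ V ⊆ J⁺(O, V)`. -/
def PastBoundaryLocallyInFuture (g : Tensor2 n N) (X : VecField n N) (M : Set N) (O : N) : Prop :=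
  ∀ U ∈ 𝓝 O, ∃ V ∈ 𝓝 O, V ⊆ U ∧ pastBoundary g X M ∩ V ⊆ causalFuture g X O V

/-! ### Continuous extensions to `M ∪ {O}` -/

/-- `f'` is a continuous extension of `f : M → ℝ` to `M ∪ {O}` (only the values of `f` on `M` and
those of `f'` on `M ∪ {O}` matter). -/
def IsContExt (M : Set N) (O : N) (f f' : N → ℝ) : Prop :=
  ContinuousOn f' (insert O M) ∧ EqOn f' f M

/-- The tensor field `T` on `M` extends continuously to `M ∪ {O}`: in some coordinates around `O`
all its components do. -/
def TensorExtends (T : Tensor2 n N) (M : Set N) (O : N) : Prop :=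
  ∃ e : OpenPartialHomeomorph N (Coord n), IsSmoothChart e ∧ O ∈ e.source ∧
    ∀ i j, ∃ f : N → ℝ, IsContExt (e.source ∩ M) O (fun x => comp T e i j (e x)) f

/-! ### Perfect fluids -/

/-- `(M, g)` solves the Einstein equations `Ric - R g / 2 = 8π [(ρ + p) u⋆ ⊗ u⋆ + p g]` with the
perfect fluid `(u, ρ, p)`. -/
structure IsPerfectFluidSolution [IsManifold (𝓡 (n + 1)) ∞ N] (g : Tensor2 n N)
    (X : VecField n N) (M : Set N) (u : VecField n N) (ρ p : N → ℝ) : Prop where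
  smooth_u : ContMDiffOn (𝓡 (n + 1)) (𝓡 (n + 1)).tangent ∞
    (fun x => (⟨x, u x⟩ : TangentBundle (𝓡 (n + 1)) N)) M
  smooth_ρ : ContMDiffOn (𝓡 (n + 1)) 𝓘(ℝ, ℝ) ∞ ρ M
  smooth_p : ContMDiffOn (𝓡 (n + 1)) 𝓘(ℝ, ℝ) ∞ p M
  unit : ∀ x ∈ M, g x (u x) (u x) = -1
  future : ∀ x ∈ M, IsFutureTimelike g X x (u x)
  einstein : ∀ x ∈ M, ∀ v w : TangentSpace (𝓡 (n + 1)) x,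
    ricci g x v w - (1 / 2) * scalarCurvature g x * g x v w =
      8 * Real.pi * ((ρ x + p x) * (g x (u x) v * g x (u x) w) + p x * g x v w)

/-- `γ : J → M` is an integral curve of `u`, defined on the nonempty open interval `J`. -/
def IsIntegralCurveIn (u : VecField n N) (M : Set N) (γ : ℝ → N) (J : Set ℝ) : Prop :=
  IsOpen J ∧ J.Nonempty ∧ J.OrdConnected ∧ MapsTo γ J M ∧ IsMIntegralCurveOn γ u J

/-- `γ : J → M` is an integral curve of `u` in `M` that cannot be extended to a larger interval. -/
def IsMaximalIntegralCurveIn (u : VecField n N) (M : Set N) (γ : ℝ → N) (J : Set ℝ) : Prop :=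
  IsIntegralCurveIn u M γ J ∧ ∀ (γ' : ℝ → N) (J' : Set ℝ), IsIntegralCurveIn u M γ' J' →
    J ⊆ J' → EqOn γ' γ J → J' = J

/-- All the integral curves of `u` have past endpoint `O`: each maximal integral curve tends to `O`
as its parameter decreases to the lower end of its interval. The extended curves are future directed
timelike on compact domains. -/
structure HasPastEndpoint (g : Tensor2 n N) (X : VecField n N) (M : Set N) (u : VecField n N)
    (O : N) : Prop where
  tendsto : ∀ (γ : ℝ → N) (J : Set ℝ), IsMaximalIntegralCurveIn u M γ J →
    Tendsto (fun t : J => γ t) atBot (𝓝 O)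
  timelike : ∀ (γ : ℝ → N) (a b : ℝ), a < b → ContinuousOn γ (Icc a b) → γ a = O →
    MapsTo γ (Ioc a b) M → IsMIntegralCurveOn γ u (Ioc a b) → IsTimelikeCurve g X γ a b

end C0Spacetime

end

open C0Spacetime

noncomputable section

namespace C0Spacetime

/-! ### Lorentzian forms -/

section Lorentz

variable {V : Type*} [AddCommGroup V] [Module ℝ V] {n : ℕ} {b : LinearMap.BilinForm ℝ V}

/-! Tracing the Einstein equations gives `R = 16π (ρ - n p) / (n - 1)` on `M`, so `R` extends
because `ρ` and `p` do. The formula at `O` then amounts to `ρ + p = 0` there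
(`IsPerfectFluidSolution.add_eq_zero`).

Suppose `ρ + p` has a nonzero limit. Solving the Einstein equations for `u⋆ ⊗ u⋆` shows that this
tensor converges at `O`. It determines `u⋆` up to sign, and the time orientation fixes the sign, so
the coordinates of `u` converge to those of a unit future timelike vector `U`
(`IsContinuousSpacetime.exists_tendsto_chartVec`).

This is incompatible with all flow lines issuing from `O` (`not_tendsto_chartVec`). Near `O` the
flow lines are almost straight of direction `U`. Take a timelike direction `v` close to `U` but not
parallel to it, and a point `O + s v`, which lies in `I⁺(O) = M`. Follow its flow line backwards. If
it stays in a small coordinate ball, it tends to `O`, so `s v` is almost a multiple of `U`, which is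
false. If it leaves the ball, it does so at a point `z` of `M` with `O - z` almost parallel to `U`,
as `s` is tiny compared with the ball. Then the segment from `z` to `O` is timelike, and `z ∈ I⁺(O)`
yields `O ∈ I⁺(O) = M`, a contradiction. -/

theorem IsLorentzForm.exists_coords (hb : IsLorentzForm n b) :
    ∃ e : Module.Basis (Fin (n + 1)) ℝ V, ∀ v w, b v w =
      -(e.repr v 0 * e.repr w 0) + ∑ i : Fin n, e.repr v i.succ * e.repr w i.succ := by
  obtain ⟨e, he⟩ := hb
  refine ⟨e, fun v w => ?_⟩
  have h : b v w = ∑ i, ∑ j, e.repr v i * (e.repr w j * b (e i) (e j)) := by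
    conv_lhs => rw [← e.sum_repr v, ← e.sum_repr w]
    simp only [map_sum, map_smul, LinearMap.sum_apply, LinearMap.smul_apply, smul_eq_mul,
      Finset.mul_sum]
    rw [Finset.sum_comm]
    refine Finset.sum_congr rfl fun i _ => Finset.sum_congr rfl fun j _ => by ring
  rw [h]
  simp only [he, mul_ite, mul_zero, Finset.sum_ite_eq, Finset.mem_univ, if_true]
  rw [Fin.sum_univ_succ]
  simp [Fin.succ_ne_zero]

theorem IsLorentzForm.symm (hb : IsLorentzForm n b) (v w : V) : b v w = b w v := by
  obtain ⟨e, he⟩ := hb.exists_coords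
  rw [he, he]
  simp only [mul_comm]

theorem IsLorentzForm.eq_zero_of_forall (hb : IsLorentzForm n b) {v : V} (hv : ∀ w, b v w = 0) :
    v = 0 := by
  obtain ⟨e, he⟩ := hb
  refine e.repr.injective (Finsupp.ext fun j => ?_)
  have h : b v (e j) = e.repr v j * (if j = 0 then -1 else 1) := by
    conv_lhs => rw [← e.sum_repr v]
    simp only [map_sum, map_smul, LinearMap.sum_apply, LinearMap.smul_apply, smul_eq_mul, he,
      mul_ite, mul_zero, Finset.sum_ite_eq', Finset.mem_univ, if_true]
  rw [hv] at h
  split_ifs at h <;> simp_all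

/-- The reverse Cauchy–Schwarz inequality for timelike vectors. -/
theorem IsLorentzForm.mul_le_sq (hb : IsLorentzForm n b) {v w : V} (hv : b v v < 0)
    (hw : b w w < 0) : b v v * b w w ≤ b v w ^ 2 := by
  obtain ⟨e, he⟩ := hb.exists_coords
  have hcs := Finset.sum_mul_sq_le_sq_mul_sq Finset.univ
    (fun i : Fin n => e.repr v i.succ) (fun i : Fin n => e.repr w i.succ)
  rw [he] at hv hw
  rw [he, he, he]
  have hA : 0 ≤ ∑ i : Fin n, e.repr v i.succ ^ 2 := Finset.sum_nonneg fun i _ => sq_nonneg _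
  have hB : 0 ≤ ∑ i : Fin n, e.repr w i.succ ^ 2 := Finset.sum_nonneg fun i _ => sq_nonneg _
  simp only [← sq] at hv hw ⊢
  generalize (∑ i : Fin n, e.repr v i.succ ^ 2) = A at *
  generalize (∑ i : Fin n, e.repr w i.succ ^ 2) = B at *
  generalize (∑ i : Fin n, e.repr v i.succ * e.repr w i.succ) = S at *
  generalize e.repr v 0 = x at *
  generalize e.repr w 0 = y at *
  -- With `α`, `β` the lengths of the spatial parts, timelikeness reads `α < |x|`, `β < |y|`, and
  -- Cauchy–Schwarz bounds the spatial product `S` by `α β`.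
  obtain ⟨α, hα, rfl⟩ : ∃ α, 0 ≤ α ∧ A = α ^ 2 := ⟨√A, Real.sqrt_nonneg _, (Real.sq_sqrt hA).symm⟩
  obtain ⟨β, hβ, rfl⟩ : ∃ β, 0 ≤ β ∧ B = β ^ 2 := ⟨√B, Real.sqrt_nonneg _, (Real.sq_sqrt hB).symm⟩
  have hS : |S| ≤ α * β := by
    rw [← mul_pow] at hcs
    exact abs_le_of_sq_le_sq hcs (by positivity)
  have hx : α ≤ |x| := by
    have := sq_lt_sq.1 (show α ^ 2 < x ^ 2 by linarith)
    rw [abs_of_nonneg hα] at this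
    exact this.le
  have hy : β ≤ |y| := by
    have := sq_lt_sq.1 (show β ^ 2 < y ^ 2 by linarith)
    rw [abs_of_nonneg hβ] at this
    exact this.le
  have h1 : α * β ≤ |x| * |y| := mul_le_mul hx hy hβ (abs_nonneg _)
  have h2 : |x| * |y| - α * β ≤ |-(x * y) + S| := by
    have := abs_sub_abs_le_abs_sub (x * y) S
    rw [abs_mul] at this
    rw [show -(x * y) + S = -(x * y - S) by ring, abs_neg]
    linarith
  have h3 : (|x| * |y| - α * β) ^ 2 ≤ (-(x * y) + S) ^ 2 := by
    rw [← sq_abs (-(x * y) + S)]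
    exact pow_le_pow_left₀ (by linarith) h2 2
  refine le_trans ?_ h3
  rw [← sq_abs x, ← sq_abs y]
  -- The difference of the two sides is exactly this square.
  nlinarith [sq_nonneg (|x| * β - |y| * α)]

end Lorentz

/-- This is the metric trace of `a g + b u⋆ ⊗ u⋆`: the inverse matrix contracts `G` to the
dimension, and contracts the lowered vector `G U` with itself to `g(U, U)`. -/
theorem sum_inv_mul_add {ι : Type*} [Fintype ι] [DecidableEq ι] {G : Matrix ι ι ℝ}
    (hdet : IsUnit G.det) (hG : G.transpose = G) (U : ι → ℝ) (a b : ℝ) :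
    ∑ i, ∑ j, G⁻¹ i j * (a * G i j + b * (G.mulVec U i * G.mulVec U j)) =
      a * Fintype.card ι + b * (U ⬝ᵥ G.mulVec U) := by
  have h1 : (G⁻¹ * G.transpose).trace = Fintype.card ι := by
    rw [hG, Matrix.nonsing_inv_mul _ hdet, Matrix.trace_one]
  have h2 : G.mulVec U ⬝ᵥ G⁻¹.mulVec (G.mulVec U) = U ⬝ᵥ G.mulVec U := by
    rw [Matrix.mulVec_mulVec, Matrix.nonsing_inv_mul _ hdet, Matrix.one_mulVec, dotProduct_comm]
  rw [← h1, ← h2]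
  generalize G.mulVec U = W
  simp only [Matrix.trace, Matrix.diag, Matrix.mul_apply, Matrix.transpose_apply, dotProduct,
    Matrix.mulVec, Finset.mul_sum, ← Finset.sum_add_distrib]
  exact Finset.sum_congr rfl fun i _ => Finset.sum_congr rfl fun j _ => by ring

variable {n : ℕ} {N : Type*} [TopologicalSpace N] [ChartedSpace (Coord n) N]

/-! ### Tensors in a chart -/

/-- The bilinear form on `ℝⁿ⁺¹` given by the components of `T` in the chart `e` at `x`. -/
def chartForm (T : Tensor2 n N) (e : OpenPartialHomeomorph N (Coord n)) (x : N)
    (v w : Coord n) : ℝ :=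
  ∑ i, ∑ j, comp T e i j (e x) * (v i * w j)

/-- The coordinates of a tangent vector at `x` in the chart `e`. -/
def chartVec (e : OpenPartialHomeomorph N (Coord n)) (x : N)
    (v : TangentSpace (𝓡 (n + 1)) x) : Coord n :=
  mfderiv (𝓡 (n + 1)) (𝓡 (n + 1)) e x v

theorem coord_eq_sum (v : Coord n) : v = ∑ i, v i • stdVec n i := by
  ext j
  simp [stdVec, Finset.sum_apply, Pi.single_apply]

theorem chartForm_eq_dotProduct (T : Tensor2 n N) (e : OpenPartialHomeomorph N (Coord n)) (x : N)
    (v w : Coord n) : chartForm T e x v w = (WithLp.ofLp v) ⬝ᵥ (compMatrix T e (e x)).mulVec w := by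
  simp only [chartForm, dotProduct, Matrix.mulVec, compMatrix, Matrix.of_apply, Finset.mul_sum]
  exact Finset.sum_congr rfl fun i _ => Finset.sum_congr rfl fun j _ => by ring

theorem comp_symm {g : Tensor2 n N} (hg : ∀ x, IsLorentzForm n (g x))
    (e : OpenPartialHomeomorph N (Coord n)) (i j : Fin (n + 1)) (y : Coord n) :
    comp g e i j y = comp g e j i y :=
  (hg _).symm _ _

variable {e : OpenPartialHomeomorph N (Coord n)}

theorem IsSmoothChart.mdifferentiable (he : IsSmoothChart e) :
    e.MDifferentiable (𝓡 (n + 1)) (𝓡 (n + 1)) :=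
  ⟨(contMDiffOn_of_mem_maximalAtlas he).mdifferentiableOn (by simp),
    (contMDiffOn_symm_of_mem_maximalAtlas he).mdifferentiableOn (by simp)⟩

theorem eq_sum_coordVec (he : IsSmoothChart e) {y : Coord n} (hy : y ∈ e.target)
    (v : TangentSpace (𝓡 (n + 1)) (e.symm y)) :
    v = ∑ i, chartVec e (e.symm y) v i • coordVec e i y := by
  have h := he.mdifferentiable.symm_comp_deriv (e.map_target hy)
  have h1 : mfderiv (𝓡 (n + 1)) (𝓡 (n + 1)) e.symm (e (e.symm y)) (chartVec e (e.symm y) v) = v :=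
    congrArg (fun L => L v) h
  rw [e.right_inv hy] at h1
  conv_lhs => rw [← h1, coord_eq_sum (chartVec e (e.symm y) v)]
  exact (map_sum _ _ _).trans (Finset.sum_congr rfl fun i _ => map_smul _ _ _)

theorem chartVec_surjective (he : IsSmoothChart e) {x : N} (hx : x ∈ e.source) :
    Function.Surjective (chartVec e x) :=
  he.mdifferentiable.mfderiv_surjective hx

theorem apply_eq_chartForm (T : Tensor2 n N) (he : IsSmoothChart e) {x : N} (hx : x ∈ e.source)
    (v w : TangentSpace (𝓡 (n + 1)) x) :
    T x v w = chartForm T e x (chartVec e x v) (chartVec e x w) := by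
  obtain ⟨y, hy, rfl⟩ : ∃ y ∈ e.target, e.symm y = x := ⟨e x, e.map_source hx, e.left_inv hx⟩
  unfold chartForm comp
  rw [e.right_inv hy]
  conv_lhs => rw [eq_sum_coordVec he hy v, eq_sum_coordVec he hy w]
  simp only [map_sum, map_smul, LinearMap.sum_apply, LinearMap.smul_apply, smul_eq_mul,
    Finset.mul_sum]
  rw [Finset.sum_comm]
  exact Finset.sum_congr rfl fun i _ => Finset.sum_congr rfl fun j _ => by ring

/-- A kernel vector of the matrix would be the coordinates of a nonzero vector orthogonal to
everything, against nondegeneracy. -/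
theorem det_compMatrix_ne_zero {g : Tensor2 n N} (hg : ∀ x, IsLorentzForm n (g x))
    (he : IsSmoothChart e) {x : N} (hx : x ∈ e.source) : (compMatrix g e (e x)).det ≠ 0 := by
  intro h
  obtain ⟨c, hc, hc0⟩ := Matrix.exists_mulVec_eq_zero_iff.2 h
  obtain ⟨v, hv⟩ := chartVec_surjective he hx (WithLp.toLp 2 c)
  have hv0 : v = 0 := (hg x).eq_zero_of_forall fun w => by
    rw [(hg x).symm, apply_eq_chartForm g he hx, hv, chartForm_eq_dotProduct]
    simp [hc0]
  apply hc
  have : chartVec e x v = 0 := by rw [hv0]; exact map_zero _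
  rw [hv] at this
  simpa using this

/-! ### The Einstein equations in coordinates and their trace. -/

variable [IsManifold (𝓡 (n + 1)) ∞ N]

theorem isSmoothChart_chartAt (x : N) : IsSmoothChart (chartAt (Coord n) x) :=
  IsManifold.chart_mem_maximalAtlas x

/-- The Einstein equations of a perfect fluid in a chart. -/
theorem IsPerfectFluidSolution.comp_ricci_eq {g : Tensor2 n N} {X u : VecField n N}
    {M : Set N} {ρ p : N → ℝ} (hg : ∀ x, IsLorentzForm n (g x))
    (h : IsPerfectFluidSolution g X M u ρ p) (he : IsSmoothChart e) {x : N} (hxe : x ∈ e.source)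
    (hx : x ∈ M) (i j : Fin (n + 1)) :
    comp (ricci g) e i j (e x) =
      (1 / 2 * scalarCurvature g x + 8 * Real.pi * p x) * compMatrix g e (e x) i j +
        8 * Real.pi * (ρ x + p x) * ((compMatrix g e (e x)).mulVec (chartVec e x (u x)) i *
          (compMatrix g e (e x)).mulVec (chartVec e x (u x)) j) := by
  obtain ⟨y, hy, rfl⟩ : ∃ y ∈ e.target, e.symm y = x := ⟨e x, e.map_source hxe, e.left_inv hxe⟩
  rw [e.right_inv hy]
  have hlow : ∀ i, g (e.symm y) (u (e.symm y)) (coordVec e i y) =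
      (compMatrix g e y).mulVec (chartVec e (e.symm y) (u (e.symm y))) i := by
    intro i
    conv_lhs => rw [eq_sum_coordVec he hy (u (e.symm y))]
    simp only [map_sum, map_smul, LinearMap.sum_apply, LinearMap.smul_apply, smul_eq_mul,
      Matrix.mulVec, dotProduct]
    refine Finset.sum_congr rfl fun j _ => ?_
    rw [mul_comm]
    congr 1
    exact comp_symm hg e j i y
  have h1 := h.einstein (e.symm y) hx (coordVec e i y) (coordVec e j y)
  rw [hlow, hlow] at h1
  have h5 : compMatrix g e y i j = g (e.symm y) (coordVec e i y) (coordVec e j y) := rfl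
  rw [h5, comp]
  linarith

/-- The trace of the Einstein equations of a perfect fluid. -/
theorem IsPerfectFluidSolution.scalarCurvature_eq {g : Tensor2 n N} {X u : VecField n N}
    {M : Set N} {ρ p : N → ℝ} (hn : 2 ≤ n) (hg : ∀ x, IsLorentzForm n (g x))
    (h : IsPerfectFluidSolution g X M u ρ p) {x : N} (hx : x ∈ M) :
    scalarCurvature g x = 16 * Real.pi / ((n : ℝ) - 1) * (ρ x - n * p x) := by
  have he : IsSmoothChart (chartAt (Coord n) x) := isSmoothChart_chartAt x
  have hxe : x ∈ (chartAt (Coord n) x).source := mem_chart_source _ x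
  have hdet := isUnit_iff_ne_zero.2 (det_compMatrix_ne_zero hg he hxe)
  have hGs : (compMatrix g (chartAt (Coord n) x) (chartAt (Coord n) x x)).transpose =
      compMatrix g (chartAt (Coord n) x) (chartAt (Coord n) x x) := by
    ext i j
    exact comp_symm hg _ j i _
  have huu := h.unit x hx
  rw [apply_eq_chartForm g he hxe, chartForm_eq_dotProduct] at huu
  -- The trace has `R` on both sides; solving for it divides by `n - 1`.
  have hR : scalarCurvature g x = (1 / 2 * scalarCurvature g x + 8 * Real.pi * p x) * (n + 1) -
      8 * Real.pi * (ρ x + p x) := by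
    conv_lhs => rw [scalarCurvature]
    simp only [h.comp_ricci_eq hg he hxe hx]
    rw [sum_inv_mul_add hdet hGs, huu, Fintype.card_fin]
    push_cast
    ring
  have hn1 : (n : ℝ) - 1 ≠ 0 := by
    have : (2 : ℝ) ≤ n := by exact_mod_cast hn
    linarith
  field_simp
  linarith

/-! ### Timelike curves -/

section Curves

variable {n : ℕ} {N : Type*} [TopologicalSpace N] [ChartedSpace (Coord n) N]
  {g : Tensor2 n N} {X u : VecField n N} {M : Set N} {e : OpenPartialHomeomorph N (Coord n)}

/-- Where `e ∘ γ` is differentiable, its derivative is the coordinate vector of `γ'`. -/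
theorem hasDerivWithinAt_chart_comp (he : IsSmoothChart e) {γ : ℝ → N} {t : ℝ} {s : Set ℝ}
    (ht : γ t ∈ e.source) {v : TangentSpace (𝓡 (n + 1)) (γ t)}
    (h : HasMFDerivWithinAt 𝓘(ℝ, ℝ) (𝓡 (n + 1)) γ s t ((1 : ℝ →L[ℝ] ℝ).smulRight v)) :
    HasDerivWithinAt (fun t => e (γ t)) (chartVec e (γ t) v) s t := by
  have h1 := (he.mdifferentiable.mdifferentiableAt ht).hasMFDerivAt.comp_hasMFDerivWithinAt t h
  have h2 : HasFDerivWithinAt (fun t => e (γ t)) ((1 : ℝ →L[ℝ] ℝ).smulRight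
      (chartVec e (γ t) v)) s t := by
    refine h1.hasFDerivWithinAt.congr_fderiv (ContinuousLinearMap.ext fun r : ℝ => ?_)
    exact map_smul (mfderiv (𝓡 (n + 1)) (𝓡 (n + 1)) e (γ t)) r v
  simpa using h2.hasDerivWithinAt

theorem hasMFDerivAt_chart_symm_comp (he : IsSmoothChart e) {c : ℝ → Coord n} {w : Coord n} {t : ℝ}
    (ht : c t ∈ e.target) (hc : HasDerivAt c w t) :
    HasMFDerivAt 𝓘(ℝ, ℝ) (𝓡 (n + 1)) (fun t => e.symm (c t)) t
      ((mfderiv (𝓡 (n + 1)) (𝓡 (n + 1)) e.symm (c t)).comp ((1 : ℝ →L[ℝ] ℝ).smulRight w)) :=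
  (he.mdifferentiable.mdifferentiableAt_symm ht).hasMFDerivAt.comp t
    hc.hasFDerivAt.hasMFDerivAt

theorem chartVec_velocity_chart_symm_comp (he : IsSmoothChart e) {c : ℝ → Coord n} {w : Coord n}
    {t : ℝ} (ht : c t ∈ e.target) (hc : HasDerivAt c w t) :
    chartVec e (e.symm (c t)) (velocity (fun t => e.symm (c t)) t) = w := by
  have h1 : velocity (fun t => e.symm (c t)) t =
      mfderiv (𝓡 (n + 1)) (𝓡 (n + 1)) e.symm (c t) w := by
    rw [velocity, (hasMFDerivAt_chart_symm_comp he ht hc).mfderiv]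
    exact congrArg (mfderiv (𝓡 (n + 1)) (𝓡 (n + 1)) e.symm (c t)) (one_smul ℝ w)
  rw [h1]
  exact congrArg (fun L => L w) (he.mdifferentiable.comp_symm_deriv ht)

/-- A segment in a chart is a timelike curve if its direction is future timelike along it. -/
theorem isTimelikeCurve_segment [IsManifold (𝓡 (n + 1)) ∞ N] (he : IsSmoothChart e)
    {y w : Coord n} {a b ε : ℝ} (hab : a < b) (hε : 0 < ε)
    (ht : ∀ t ∈ Icc a b, y + (t - a) • w ∈ e.target)
    (hQ : ∀ t ∈ Icc a b, chartForm g e (e.symm (y + (t - a) • w)) w w < -ε)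
    (hL : ∀ t ∈ Icc a b, chartForm g e (e.symm (y + (t - a) • w))
      (chartVec e (e.symm (y + (t - a) • w)) (X (e.symm (y + (t - a) • w)))) w < 0) :
    IsTimelikeCurve g X (fun t => e.symm (y + (t - a) • w)) a b := by
  have hsm : ContDiff ℝ ∞ fun t : ℝ => y + (t - a) • w := by fun_prop
  have hder : ∀ t : ℝ, HasDerivAt (fun t : ℝ => y + (t - a) • w) w t := fun t => by
    simpa using (((hasDerivAt_id t).sub_const a).smul_const w).const_add y
  have hmd : ∀ t ∈ Icc a b, ContMDiffAt 𝓘(ℝ, ℝ) (𝓡 (n + 1)) ∞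
      (fun t => e.symm (y + (t - a) • w)) t := fun t h =>
    ContMDiffAt.comp t (contMDiffAt_symm_of_mem_maximalAtlas he (ht t h))
      hsm.contMDiff.contMDiffAt
  refine ⟨hab, ⟨fun t h => (hmd t h).continuousAt.continuousWithinAt, fun t h => ?_⟩, ε, hε, ?_⟩
  · have h1 : ContMDiffAt 𝓘(ℝ, ℝ) (𝓡 (n + 1)) ∞ (chartAt (Coord n) (e.symm (y + (t - a) • w)) ∘
        fun t => e.symm (y + (t - a) • w)) t :=
      ContMDiffAt.comp t (contMDiffAt_of_mem_maximalAtlas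
        (IsManifold.chart_mem_maximalAtlas _) (mem_chart_source _ _)) (hmd t h)
    obtain ⟨K, s, hs, hK⟩ := (h1.contDiffAt.of_le (by simp)).exists_lipschitzOnWith
    exact ⟨K, s, mem_nhdsWithin_of_mem_nhds hs, hK⟩
  · refine (ae_restrict_iff' measurableSet_Ioo).2 (Eventually.of_forall fun t h => ?_)
    have h' := Ioo_subset_Icc_self h
    have hmem := e.map_target (ht t h')
    have hv := chartVec_velocity_chart_symm_comp he (ht t h') (hder t)
    have hq := hQ t h'
    unfold IsFutureTimelike
    rw [apply_eq_chartForm g he hmem, apply_eq_chartForm g he hmem, hv]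
    exact ⟨⟨by linarith, hL t h'⟩, hq⟩

/-- The two velocities live in different tangent spaces as types; `key` regards both as vectors of
`Coord n`, so that the base points can be identified by substitution. -/
theorem timelike_velocity_congr {γ γ' : ℝ → N} {t ε : ℝ} (h : γ =ᶠ[𝓝 t] γ')
    (hγ : IsFutureTimelike g X (γ t) (velocity γ t) ∧
      g (γ t) (velocity γ t) (velocity γ t) < -ε) :
    IsFutureTimelike g X (γ' t) (velocity γ' t) ∧
      g (γ' t) (velocity γ' t) (velocity γ' t) < -ε := by
  have key : ∀ (x x' : N) (v v' : Coord n), x = x' → v = v' →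
      (IsFutureTimelike g X x v ∧ g x v v < -ε) → (IsFutureTimelike g X x' v' ∧ g x' v' v' < -ε) := by
    rintro x _ v _ rfl rfl h
    exact h
  refine key _ _ _ _ h.self_of_nhds ?_ hγ
  unfold velocity
  exact congrArg (fun L : ℝ →L[ℝ] Coord n => L 1) h.mfderiv_eq

/-- Distances on the line add up through the common point `b` that separates `s` from `t`. -/
theorem lipschitzOnWith_union {E : Type*} [PseudoMetricSpace E] {f : ℝ → E} {s t : Set ℝ} {b : ℝ}
    {K L : NNReal} (hs : ∀ x ∈ s, x ≤ b) (ht : ∀ x ∈ t, b ≤ x) (hbs : b ∈ s) (hbt : b ∈ t)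
    (hfs : LipschitzOnWith K f s) (hft : LipschitzOnWith L f t) :
    LipschitzOnWith (max K L) f (s ∪ t) := by
  have hs' := hfs.weaken (le_max_left K L)
  have ht' := hft.weaken (le_max_right K L)
  have key : ∀ x ∈ s, ∀ y ∈ t, dist (f x) (f y) ≤ (max K L : NNReal) * dist x y := by
    intro x hx y hy
    have h1 := hs'.dist_le_mul x hx b hbs
    have h2 := ht'.dist_le_mul b hbt y hy
    have h3 := dist_triangle (f x) (f b) (f y)
    have h4 : dist x y = dist x b + dist b y := by
      rw [Real.dist_eq, Real.dist_eq, Real.dist_eq, abs_of_nonpos, abs_of_nonpos, abs_of_nonpos] <;>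
      linarith [hs x hx, ht y hy]
    rw [h4, mul_add]
    linarith
  refine LipschitzOnWith.of_dist_le_mul ?_
  rintro x (hx | hx) y (hy | hy)
  · exact hs'.dist_le_mul x hx y hy
  · exact key x hx y hy
  · rw [dist_comm, dist_comm x]
    exact key y hy x hx
  · exact ht'.dist_le_mul x hx y hy

/-- Timelike curves can be concatenated. -/
theorem IsTimelikeCurve.concat {γ₁ γ₂ : ℝ → N} {a b c : ℝ} (h₁ : IsTimelikeCurve g X γ₁ a b)
    (h₂ : IsTimelikeCurve g X γ₂ b c) (h : γ₁ b = γ₂ b) :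
    IsTimelikeCurve g X (fun t => if t ≤ b then γ₁ t else γ₂ t) a c := by
  obtain ⟨hab, ⟨hc₁, hl₁⟩, ε₁, hε₁, hv₁⟩ := h₁
  obtain ⟨hbc, ⟨hc₂, hl₂⟩, ε₂, hε₂, hv₂⟩ := h₂
  set γ : ℝ → N := fun t => if t ≤ b then γ₁ t else γ₂ t with hγ
  have e₁ : ∀ t, t ≤ b → γ t = γ₁ t := fun t ht => if_pos ht
  have e₂ : ∀ t, b ≤ t → γ t = γ₂ t := fun t ht => by
    rcases ht.eq_or_lt with rfl | ht
    · rw [e₁ b le_rfl, h]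
    · exact if_neg (not_le.2 ht)
  have hunion : Icc a c = Icc a b ∪ Icc b c := (Icc_union_Icc_eq_Icc hab.le hbc.le).symm
  refine ⟨hab.trans hbc, ⟨?_, ?_⟩, min ε₁ ε₂, lt_min hε₁ hε₂, ?_⟩
  · rw [hunion]
    exact (hc₁.congr fun t ht => e₁ t ht.2).union_of_isClosed (hc₂.congr fun t ht => e₂ t ht.1)
      isClosed_Icc isClosed_Icc
  · intro t ht
    rcases lt_trichotomy t b with htb | rfl | htb
    · obtain ⟨K, s, hs, hK⟩ := hl₁ t ⟨ht.1, htb.le⟩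
      refine ⟨K, s ∩ Iio b, ?_, ?_⟩
      · have : Icc a b ∩ Iio b = Icc a c ∩ Iio b := by
          ext x; simp only [mem_inter_iff, mem_Icc, mem_Iio]; grind
        refine inter_mem ?_ (mem_nhdsWithin_of_mem_nhds (Iio_mem_nhds htb))
        rwa [← nhdsWithin_inter_of_mem' (mem_nhdsWithin_of_mem_nhds (Iio_mem_nhds htb)), ← this,
          nhdsWithin_inter_of_mem' (mem_nhdsWithin_of_mem_nhds (Iio_mem_nhds htb))]
      · intro x hx y hy
        simp only [Function.comp, e₁ t htb.le, e₁ x hx.2.le, e₁ y hy.2.le]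
        exact hK hx.1 hy.1
    · obtain ⟨K₁, s₁, hs₁, hK₁⟩ := hl₁ t ⟨hab.le, le_rfl⟩
      obtain ⟨K₂, s₂, hs₂, hK₂⟩ := hl₂ t ⟨le_rfl, hbc.le⟩
      refine ⟨max K₁ K₂, (s₁ ∩ Icc a t) ∪ (s₂ ∩ Icc t c), ?_, ?_⟩
      · rw [hunion, nhdsWithin_union]
        exact ⟨mem_of_superset (inter_mem hs₁ self_mem_nhdsWithin) subset_union_left,
          mem_of_superset (inter_mem hs₂ self_mem_nhdsWithin) subset_union_right⟩
      · have ht₁ : t ∈ Icc a t := ⟨hab.le, le_rfl⟩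
        have ht₂ : t ∈ Icc t c := ⟨le_rfl, hbc.le⟩
        rw [e₁ t le_rfl]
        refine lipschitzOnWith_union (b := t) (fun x hx => hx.2.2) (fun x hx => hx.2.1)
          ⟨mem_of_mem_nhdsWithin ht₁ hs₁, ht₁⟩ ⟨mem_of_mem_nhdsWithin ht₂ hs₂, ht₂⟩
          (fun x hx y hy => ?_) (fun x hx y hy => ?_)
        · simp only [Function.comp, e₁ x hx.2.2, e₁ y hy.2.2]
          exact hK₁ hx.1 hy.1
        · simp only [Function.comp, e₂ x hx.2.1, e₂ y hy.2.1]
          rw [h]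
          exact hK₂ hx.1 hy.1
    · obtain ⟨K, s, hs, hK⟩ := hl₂ t ⟨htb.le, ht.2⟩
      refine ⟨K, s ∩ Ioi b, ?_, ?_⟩
      · have : Icc b c ∩ Ioi b = Icc a c ∩ Ioi b := by
          ext x; simp only [mem_inter_iff, mem_Icc, mem_Ioi]; grind
        refine inter_mem ?_ (mem_nhdsWithin_of_mem_nhds (Ioi_mem_nhds htb))
        rwa [← nhdsWithin_inter_of_mem' (mem_nhdsWithin_of_mem_nhds (Ioi_mem_nhds htb)), ← this,
          nhdsWithin_inter_of_mem' (mem_nhdsWithin_of_mem_nhds (Ioi_mem_nhds htb))]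
      · intro x hx y hy
        have hxb : b < x := hx.2
        have hyb : b < y := hy.2
        simp only [Function.comp, e₂ t htb.le, e₂ x hxb.le, e₂ y hyb.le]
        exact hK hx.1 hy.1
  · rw [ae_restrict_iff' measurableSet_Ioo] at hv₁ hv₂ ⊢
    -- The junction may be a corner, but a single parameter is a null set.
    filter_upwards [hv₁, hv₂, Measure.ae_ne volume b] with t h₁ h₂ htb ht
    rcases lt_or_gt_of_ne htb with htb | htb
    · have := timelike_velocity_congr (γ' := γ) (eventually_of_mem (Iio_mem_nhds htb)
        fun x hx => (e₁ x (le_of_lt hx)).symm) (h₁ ⟨ht.1, htb⟩)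
      exact ⟨this.1, this.2.trans_le (neg_le_neg (min_le_left _ _))⟩
    · have := timelike_velocity_congr (γ' := γ) (eventually_of_mem (Ioi_mem_nhds htb)
        fun x hx => (e₂ x (le_of_lt hx)).symm) (h₂ ⟨htb, ht.2⟩)
      exact ⟨this.1, this.2.trans_le (neg_le_neg (min_le_right _ _))⟩

/-! ### Maximal integral curves -/

/-- Through every point of `M` passes a maximal integral curve. -/
theorem exists_isMaximalIntegralCurveIn [IsManifold (𝓡 (n + 1)) ∞ N] (hM : IsOpen M)
    (hu : ContMDiffOn (𝓡 (n + 1)) (𝓡 (n + 1)).tangent ∞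
      (fun x => (⟨x, u x⟩ : TangentBundle (𝓡 (n + 1)) N)) M) {q : N} (hq : q ∈ M) :
    ∃ (γ : ℝ → N) (J : Set ℝ), IsMaximalIntegralCurveIn u M γ J ∧ (0 : ℝ) ∈ J ∧ γ 0 = q := by
  have : IsManifold (𝓡 (n + 1)) 1 N := IsManifold.of_le (n := ∞) (by simp)
  obtain ⟨γ₀, hγ₀, hc₀⟩ := exists_isMIntegralCurveAt_of_contMDiffAt_boundaryless (t₀ := 0)
    (((hu q hq).contMDiffAt (hM.mem_nhds hq)).of_le (by simp))
  obtain ⟨ε, hε, hcε⟩ := isMIntegralCurveAt_iff'.1 hc₀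
  obtain ⟨δ, hδ, hcδ⟩ := Metric.eventually_nhds_iff_ball.1
    (hc₀.continuousAt.eventually (hM.mem_nhds (by rwa [hγ₀])))
  have hstart : IsIntegralCurveIn u M γ₀ (Metric.ball 0 (min ε δ)) := by
    refine ⟨Metric.isOpen_ball, ⟨0, Metric.mem_ball_self (lt_min hε hδ)⟩,
      (convex_ball _ _).ordConnected, fun t ht => hcδ t ?_, hcε.mono ?_⟩
    · exact Metric.ball_subset_ball (min_le_right _ _) ht
    · exact Metric.ball_subset_ball (min_le_left _ _)
  -- Zorn's lemma on curves through `q` ordered by extension. Since the order includes agreement on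
  -- the smaller interval, members of a chain glue without appeal to uniqueness of integral curves.
  let A := {c : (ℝ → N) × Set ℝ // IsIntegralCurveIn u M c.1 c.2 ∧ 0 ∈ c.2 ∧ c.1 0 = q}
  let r : A → A → Prop := fun c d => c.1.2 ⊆ d.1.2 ∧ EqOn d.1.1 c.1.1 c.1.2
  have hA : Nonempty A := ⟨⟨(γ₀, _), hstart, Metric.mem_ball_self (lt_min hε hδ), hγ₀⟩⟩
  have hmax : ∃ m : A, ∀ d, r m d → r d m := by
    refine exists_maximal_of_nonempty_chains_bounded ?_ ?_
    · intro c hc hne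
      let J : Set ℝ := ⋃ d ∈ c, d.1.2
      classical
      let γ : ℝ → N := fun t => if h : ∃ d ∈ c, t ∈ d.1.2 then h.choose.1.1 t else q
      have hγ : ∀ d ∈ c, EqOn γ d.1.1 d.1.2 := by
        intro d hd t ht
        have h : ∃ d ∈ c, t ∈ d.1.2 := ⟨d, hd, ht⟩
        have h1 : γ t = h.choose.1.1 t := dif_pos h
        rw [h1]
        by_cases hdd : h.choose = d
        · rw [hdd]
        rcases hc h.choose_spec.1 hd hdd with h2 | h2
        · exact (h2.2 h.choose_spec.2).symm
        · exact h2.2 ht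
      have hopen : ∀ d ∈ c, IsOpen d.1.2 := fun d hd => d.2.1.1
      obtain ⟨d₀, hd₀⟩ := hne
      have hsub : ∀ d ∈ c, d.1.2 ⊆ J := fun d hd => subset_biUnion_of_mem (u := fun d : A => d.1.2) hd
      refine ⟨⟨(γ, J), ⟨isOpen_biUnion hopen, ⟨0, hsub d₀ hd₀ d₀.2.2.1⟩, ?_, ?_, ?_⟩,
        hsub d₀ hd₀ d₀.2.2.1, ?_⟩, fun d hd => ⟨hsub d hd, hγ d hd⟩⟩
      · refine IsPreconnected.ordConnected ?_
        refine isPreconnected_of_forall 0 fun t ht => ?_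
        obtain ⟨d, hd, htd⟩ := mem_iUnion₂.1 ht
        exact ⟨d.1.2, hsub d hd, d.2.2.1, htd, d.2.1.2.2.1.isPreconnected⟩
      · intro t ht
        obtain ⟨d, hd, htd⟩ := mem_iUnion₂.1 ht
        change γ t ∈ M
        rw [hγ d hd htd]
        exact d.2.1.2.2.2.1 htd
      · intro t ht
        obtain ⟨d, hd, htd⟩ := mem_iUnion₂.1 ht
        have hnhds := (hopen d hd).mem_nhds htd
        have h1 := (d.2.1.2.2.2.2 t htd).hasMFDerivAt hnhds
        have h2 := (h1.congr_of_eventuallyEq (eventually_of_mem hnhds (hγ d hd))).hasMFDerivWithinAt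
          (s := J)
        have key : ∀ x x' : N, x = x' → (u x : Coord n) = u x' := by rintro x _ rfl; rfl
        have h3 := key _ _ (hγ d hd htd)
        change HasMFDerivWithinAt 𝓘(ℝ, ℝ) (𝓡 (n + 1)) γ J t
          ((1 : ℝ →L[ℝ] ℝ).smulRight (u (γ t) : Coord n))
        rw [h3]
        exact h2
      · exact (hγ d₀ hd₀ d₀.2.2.1).trans d₀.2.2.2
    · intro a b c hab hbc
      exact ⟨hab.1.trans hbc.1, fun t ht => (hbc.2 (hab.1 ht)).trans (hab.2 ht)⟩
  obtain ⟨m, hm⟩ := hmax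
  refine ⟨m.1.1, m.1.2, ⟨m.2.1, fun γ' J' h' hJ hE => ?_⟩, m.2.2.1, m.2.2.2⟩
  have := hm ⟨(γ', J'), h', hJ m.2.2.1, (hE m.2.2.1).trans m.2.2.2⟩ ⟨hJ, hE⟩
  exact this.1.antisymm hJ

end Curves

/-! ### Limits at a point -/

section Limits

variable {n : ℕ} {N : Type*} [TopologicalSpace N] [ChartedSpace (Coord n) N]
  [IsManifold (𝓡 (n + 1)) ∞ N]
  {g : Tensor2 n N} {X u : VecField n N} {M : Set N} {e : OpenPartialHomeomorph N (Coord n)} {O : N}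

/-- The tangent map of the chart is continuous, and the tangent bundle of the model space is a
product; the vector part is the second factor. -/
theorem continuousOn_chartVec (he : IsSmoothChart e)
    (hX : Continuous fun x => (⟨x, X x⟩ : TangentBundle (𝓡 (n + 1)) N)) :
    ContinuousOn (fun x => chartVec e x (X x)) e.source := by
  have h1 := (contMDiffOn_of_mem_maximalAtlas he).continuousOn_tangentMapWithin (by simp)
    e.open_source.uniqueMDiffOn
  have h2 := ((tangentBundleModelSpaceHomeomorph (𝓡 (n + 1))).continuous.comp_continuousOn h1).comp
    hX.continuousOn (s := e.source) (fun x hx => hx)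
  have h3 := (continuous_snd (X := Coord n) (Y := Coord n)).comp_continuousOn h2
  refine h3.congr fun x hx => ?_
  change mfderiv (𝓡 (n + 1)) (𝓡 (n + 1)) e x (X x) =
    mfderivWithin (𝓡 (n + 1)) (𝓡 (n + 1)) e e.source x (X x)
  rw [mfderivWithin_of_isOpen e.open_source hx]

theorem IsContinuousSpacetime.tendsto_comp (hg : IsContinuousSpacetime g X) (he : IsSmoothChart e)
    (hO : O ∈ e.source) (i j : Fin (n + 1)) :
    Tendsto (fun x => comp g e i j (e x)) (𝓝 O) (𝓝 (comp g e i j (e O))) :=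
  ((hg.continuous_metric e he i j).continuousAt (e.open_target.mem_nhds (e.map_source hO))).tendsto.comp
    (e.continuousAt hO)

theorem IsContinuousSpacetime.tendsto_chartForm (hg : IsContinuousSpacetime g X)
    (he : IsSmoothChart e) (hO : O ∈ e.source) {α : Type*} {l : Filter α} {x : α → N}
    {v w : α → Coord n} {v₀ w₀ : Coord n} (hx : Tendsto x l (𝓝 O)) (hv : Tendsto v l (𝓝 v₀))
    (hw : Tendsto w l (𝓝 w₀)) :
    Tendsto (fun a => chartForm g e (x a) (v a) (w a)) l (𝓝 (chartForm g e O v₀ w₀)) := by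
  have hc : ∀ (i : Fin (n + 1)) {v : α → Coord n} {v₀ : Coord n}, Tendsto v l (𝓝 v₀) →
      Tendsto (fun a => v a i) l (𝓝 (v₀ i)) := fun i v v₀ hv =>
    ((EuclideanSpace.proj i : Coord n →L[ℝ] ℝ).continuous.tendsto v₀).comp hv
  exact tendsto_finsetSum _ fun i _ => tendsto_finsetSum _ fun j _ =>
    ((hg.tendsto_comp he hO i j).comp hx).mul ((hc i hv).mul (hc j hw))

theorem tendsto_matrix_inv {ι α : Type*} [Fintype ι] [DecidableEq ι] {l : Filter α}
    {A : α → Matrix ι ι ℝ} {B : Matrix ι ι ℝ} (h : Tendsto A l (𝓝 B)) (hB : B.det ≠ 0) :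
    Tendsto (fun a => (A a)⁻¹) l (𝓝 B⁻¹) := by
  simp only [Matrix.inv_def, Ring.inverse_eq_inv']
  have h1 : Tendsto (fun a => (A a).det) l (𝓝 B.det) :=
    ((continuous_id.matrix_det).tendsto B).comp h
  have h2 : Tendsto (fun a => (A a).adjugate) l (𝓝 B.adjugate) :=
    ((continuous_id.matrix_adjugate).tendsto B).comp h
  exact (h1.inv₀ hB).smul h2

/-- A unit future timelike vector field `u` converges if the tensor field `u⋆ ⊗ u⋆` does. -/
theorem IsContinuousSpacetime.exists_tendsto_chartVec (hg : IsContinuousSpacetime g X)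
    (he : IsSmoothChart e) (hO : O ∈ e.source) [NeBot (𝓝[M] O)]
    (hunit : ∀ x ∈ M, g x (u x) (u x) = -1) (hfut : ∀ x ∈ M, IsFutureTimelike g X x (u x))
    (hlim : ∀ i j, ∃ A, Tendsto (fun x => (compMatrix g e (e x)).mulVec (chartVec e x (u x)) i *
      (compMatrix g e (e x)).mulVec (chartVec e x (u x)) j) (𝓝[M] O) (𝓝 A)) :
    ∃ U : Coord n, Tendsto (fun x => chartVec e x (u x)) (𝓝[M] O) (𝓝 U) ∧
      chartForm g e O U U = -1 ∧ chartForm g e O (chartVec e O (X O)) U < 0 := by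
  choose A hA using hlim
  -- `θ` holds the components of `u⋆`, and `a` below is `g(X, u) = Yⁱ θᵢ`. Contracting the
  -- convergent products `θᵢ θⱼ` with `Y` gives the limit `α` of `a²`.
  set θ : Fin (n + 1) → N → ℝ := fun i x => (compMatrix g e (e x)).mulVec (chartVec e x (u x)) i
    with hθ
  set Y : N → Coord n := fun x => chartVec e x (X x) with hY
  have hOle : 𝓝[M] O ≤ 𝓝 O := nhdsWithin_le_nhds
  have hid : Tendsto (fun x : N => x) (𝓝[M] O) (𝓝 O) := hOle
  have hYlim : Tendsto Y (𝓝[M] O) (𝓝 (Y O)) :=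
    ((continuousOn_chartVec he hg.continuous_orientation).continuousAt
      (e.open_source.mem_nhds hO)).tendsto.mono_left hOle
  have hYi : ∀ i, Tendsto (fun x => Y x i) (𝓝[M] O) (𝓝 (Y O i)) := fun i =>
    ((EuclideanSpace.proj i : Coord n →L[ℝ] ℝ).continuous.tendsto _).comp hYlim
  have hev : ∀ᶠ x in 𝓝[M] O, x ∈ e.source ∧ x ∈ M :=
    (eventually_of_mem (hOle (e.open_source.mem_nhds hO)) fun _ h => h).and
      (eventually_of_mem self_mem_nhdsWithin fun _ h => h)
  set a : N → ℝ := fun x => ∑ i, Y x i * θ i x with ha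
  have haX : ∀ x ∈ e.source, g x (X x) (u x) = a x := by
    intro x hx
    rw [apply_eq_chartForm g he hx, chartForm_eq_dotProduct]
    rfl
  have hsq : Tendsto (fun x => a x ^ 2) (𝓝[M] O) (𝓝 (∑ i, ∑ j, Y O i * Y O j * A i j)) := by
    have h1 : ∀ x, a x ^ 2 = ∑ i, ∑ j, Y x i * Y x j * (θ i x * θ j x) := by
      intro x
      rw [sq, ha, Finset.sum_mul_sum]
      exact Finset.sum_congr rfl fun i _ => Finset.sum_congr rfl fun j _ => by ring
    simp only [h1]
    exact tendsto_finsetSum _ fun i _ => tendsto_finsetSum _ fun j _ =>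
      ((hYi i).mul (hYi j)).mul (hA i j)
  set α := ∑ i, ∑ j, Y O i * Y O j * A i j with hα
  have hαpos : 0 < α := by
    -- Reverse Cauchy–Schwarz with `g(u, u) = -1` gives `a² ≥ -g(X, X)`, which stays away from zero
    -- at `O`.
    have h1 : -chartForm g e O (Y O) (Y O) ≤ α := by
      refine le_of_tendsto_of_tendsto (hg.tendsto_chartForm he hO hid hYlim hYlim).neg hsq ?_
      filter_upwards [hev] with x hx
      have h2 := (hg.lorentz x).mul_le_sq (hg.timelike_orientation x) (hfut x hx.2).1
      rw [hunit x hx.2, haX x hx.1, apply_eq_chartForm g he hx.1] at h2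
      simpa using h2
    have h2 := hg.timelike_orientation O
    rw [apply_eq_chartForm g he hO] at h2
    linarith
  -- The future direction of `u` makes `a` negative and so selects the root.
  have halim : Tendsto a (𝓝[M] O) (𝓝 (-√α)) := by
    refine (hsq.sqrt.neg).congr' ?_
    filter_upwards [hev] with x hx
    have h1 : a x < 0 := by rw [← haX x hx.1]; exact (hfut x hx.2).2
    rw [Real.sqrt_sq_eq_abs, abs_of_neg h1, neg_neg]
  have hsqrt : 0 < √α := Real.sqrt_pos.2 hαpos
  -- Here `θᵢ = (Yʲ θᵢ θⱼ) / a`; raising the index with the inverse metric then recovers `u` itself.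
  have hθlim : ∀ i, Tendsto (θ i) (𝓝[M] O) (𝓝 ((∑ j, Y O j * A i j) / -√α)) := by
    intro i
    have h1 : Tendsto (fun x => (∑ j, Y x j * (θ i x * θ j x)) / a x) (𝓝[M] O)
        (𝓝 ((∑ j, Y O j * A i j) / -√α)) :=
      (tendsto_finsetSum _ fun j _ => (hYi j).mul (hA i j)).div halim (by linarith)
    refine h1.congr' ?_
    filter_upwards [hev] with x hx
    have h2 : a x < 0 := by rw [← haX x hx.1]; exact (hfut x hx.2).2
    rw [div_eq_iff h2.ne, ha, Finset.mul_sum]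
    exact Finset.sum_congr rfl fun j _ => by ring
  have hG : Tendsto (fun x => compMatrix g e (e x)) (𝓝[M] O) (𝓝 (compMatrix g e (e O))) := by
    refine tendsto_pi_nhds.2 fun i => tendsto_pi_nhds.2 fun j => ?_
    exact (hg.tendsto_comp he hO i j).mono_left hOle
  have hGinv := tendsto_matrix_inv hG (det_compMatrix_ne_zero hg.lorentz he hO)
  set U : Coord n := WithLp.toLp 2 ((compMatrix g e (e O))⁻¹.mulVec
    fun i => (∑ j, Y O j * A i j) / -√α) with hU
  have hUlim : Tendsto (fun x => chartVec e x (u x)) (𝓝[M] O) (𝓝 U) := by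
    have h1 : Tendsto (fun x => WithLp.toLp 2 ((compMatrix g e (e x))⁻¹.mulVec fun i => θ i x))
        (𝓝[M] O) (𝓝 U) := by
      refine ((PiLp.continuous_toLp 2 _).tendsto _).comp (tendsto_pi_nhds.2 fun i => ?_)
      simp only [Matrix.mulVec, dotProduct]
      refine tendsto_finsetSum _ fun j _ => Tendsto.mul ?_ (hθlim j)
      exact tendsto_pi_nhds.1 (tendsto_pi_nhds.1 hGinv i) j
    refine h1.congr' ?_
    filter_upwards [hev] with x hx
    have h2 : (fun i => θ i x) = (compMatrix g e (e x)).mulVec (chartVec e x (u x)) := rfl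
    rw [h2, Matrix.mulVec_mulVec, Matrix.nonsing_inv_mul _
      (isUnit_iff_ne_zero.2 (det_compMatrix_ne_zero hg.lorentz he hx.1)), Matrix.one_mulVec]
  refine ⟨U, hUlim, ?_, ?_⟩
  · refine tendsto_nhds_unique (hg.tendsto_chartForm he hO hid hUlim hUlim) ?_
    refine tendsto_const_nhds.congr' ?_
    filter_upwards [hev] with x hx
    rw [← apply_eq_chartForm g he hx.1, hunit x hx.2]
  · have h1 : chartForm g e O (Y O) U = -√α := by
      refine tendsto_nhds_unique (hg.tendsto_chartForm he hO hid hYlim hUlim) ?_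
      refine halim.congr' ?_
      filter_upwards [hev] with x hx
      rw [← haX x hx.1, apply_eq_chartForm g he hx.1]
    rw [h1]
    linarith

end Limits

/-! ### A velocity field issuing from a point has no limit there -/

/-- Perturb `U` by a small multiple of a vector off its line. The line is closed, so the perturbed
vector has a positive distance `d` to it. -/
theorem exists_near_not_parallel {E : Type*} [NormedAddCommGroup E] [NormedSpace ℝ E]
    [FiniteDimensional ℝ E] (hE : 1 < Module.finrank ℝ E) (U : E) {δ : ℝ} (hδ : 0 < δ) :
    ∃ v : E, ‖v - U‖ < δ ∧ ∃ d > 0, ∀ c : ℝ, d ≤ ‖v - c • U‖ := by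
  obtain ⟨z, hz⟩ : ∃ z, z ∉ Submodule.span ℝ {U} := by
    by_contra! h
    have h1 : Submodule.span ℝ {U} = ⊤ := (Submodule.eq_top_iff').2 h
    have h2 := finrank_span_le_card (R := ℝ) ({U} : Set E)
    rw [h1, finrank_top] at h2
    simp at h2
    omega
  have hη : 0 < δ / (2 * (‖z‖ + 1)) := by positivity
  set η := δ / (2 * (‖z‖ + 1)) with hη_def
  have hv : U + η • z ∉ Submodule.span ℝ {U} := by
    intro h
    have h1 := Submodule.sub_mem _ h (Submodule.mem_span_singleton_self U)
    rw [add_sub_cancel_left] at h1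
    exact hz ((Submodule.smul_mem_iff _ hη.ne').1 h1)
  refine ⟨U + η • z, ?_, Metric.infDist (U + η • z) (Submodule.span ℝ {U}), ?_, fun c => ?_⟩
  · rw [add_sub_cancel_left, norm_smul, Real.norm_of_nonneg hη.le, hη_def, div_mul_eq_mul_div,
      div_lt_iff₀ (by positivity)]
    nlinarith [norm_nonneg z]
  · exact ((Submodule.closed_of_finiteDimensional (Submodule.span ℝ {U})).notMem_iff_infDist_pos
      (Submodule.nonempty _)).1 hv
  · rw [← dist_eq_norm]
    exact Metric.infDist_le_dist_of_mem
      (Submodule.smul_mem _ c (Submodule.mem_span_singleton_self U))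

section PastEndpoint

variable {n : ℕ} {N : Type*} [TopologicalSpace N] [ChartedSpace (Coord n) N]
  {g : Tensor2 n N} {X u : VecField n N} {M : Set N} {e : OpenPartialHomeomorph N (Coord n)} {O : N}

/-- An integral curve of a vector field close to `U` is close to a line of direction `U`. -/
theorem norm_chart_sub_le_of_integralCurve (he : IsSmoothChart e) {U : Coord n} {ε : ℝ}
    {γ : ℝ → N} {a b : ℝ} (hab : a ≤ b) (hγ : IsMIntegralCurveOn γ u (Icc a b))
    (hsrc : ∀ t ∈ Icc a b, γ t ∈ e.source)
    (hU : ∀ t ∈ Icc a b, ‖chartVec e (γ t) (u (γ t)) - U‖ ≤ ε) :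
    ‖e (γ b) - e (γ a) - (b - a) • U‖ ≤ ε * (b - a) := by
  have h1 : ∀ t ∈ Icc a b, HasDerivWithinAt (fun t => e (γ t) - t • U)
      (chartVec e (γ t) (u (γ t)) - U) (Icc a b) t := by
    intro t ht
    have h2 := (hasDerivWithinAt_chart_comp he (hsrc t ht) (hγ t ht)).sub
      (((hasDerivAt_id t).smul_const U).hasDerivWithinAt (s := Icc a b))
    rw [one_smul] at h2
    exact h2
  have h3 := (convex_Icc a b).norm_image_sub_le_of_norm_hasDerivWithin_le h1 hU
    (left_mem_Icc.2 hab) (right_mem_Icc.2 hab)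
  rw [Real.norm_of_nonneg (sub_nonneg.2 hab)] at h3
  have h4 : e (γ b) - e (γ a) - (b - a) • U = e (γ b) - b • U - (e (γ a) - a • U) := by module
  rwa [h4]

theorem IsContExt.tendsto {f f' : N → ℝ} (h : IsContExt M O f f') :
    Tendsto f (𝓝[M] O) (𝓝 (f' O)) :=
  ((h.1 O (mem_insert _ _)).tendsto.mono_left (nhdsWithin_mono _ (subset_insert _ _))).congr'
    (eventually_of_mem self_mem_nhdsWithin h.2)

variable [IsManifold (𝓡 (n + 1)) ∞ N]

/-- Segments in a chart whose directions are close to `U` are timelike, if all directions close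
to `U` are uniformly timelike and future directed on a coordinate ball. -/
theorem isTimelikeCurve_segment_of_closedBall (he : IsSmoothChart e) {c U : Coord n} {r δ ε : ℝ}
    (hε : 0 < ε)
    (hC : ∀ y ∈ Metric.closedBall c r, y ∈ e.target ∧ ∀ w, ‖w - U‖ < δ →
      chartForm g e (e.symm y) w w < -ε ∧
      chartForm g e (e.symm y) (chartVec e (e.symm y) (X (e.symm y))) w < 0)
    {y w : Coord n} {T : ℝ} (hT : 0 < T) (hw : ‖w - U‖ < δ) (hy : y ∈ Metric.closedBall c r)
    (hy' : y + T • w ∈ Metric.closedBall c r) (a : ℝ) :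
    IsTimelikeCurve g X (fun t => e.symm (y + (t - a) • w)) a (a + T) := by
  have hmem : ∀ t ∈ Icc a (a + T), y + (t - a) • w ∈ Metric.closedBall c r := by
    intro t ht
    have h1 := (convex_closedBall c r).add_smul_sub_mem hy hy'
      (t := (t - a) / T) ⟨div_nonneg (by linarith [ht.1]) hT.le,
        (div_le_one hT).2 (by linarith [ht.2])⟩
    rwa [add_sub_cancel_left, smul_smul, div_mul_cancel₀ _ hT.ne'] at h1
  exact isTimelikeCurve_segment he (by linarith) hε (fun t ht => (hC _ (hmem t ht)).1)
    (fun t ht => ((hC _ (hmem t ht)).2 w hw).1) (fun t ht => ((hC _ (hmem t ht)).2 w hw).2)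

/-- If all integral curves of `u` issue from `O`, then the coordinates of `u` do not converge to
those of a future timelike vector at `O`. No causality condition at `O` is needed: an integral curve
that leaves a small coordinate ball backwards from a point very close to `O` leaves it in the
timelike past of `O`, so that `O` would lie in its own timelike future `M`. -/
theorem not_tendsto_chartVec [T2Space N] (hn : 1 ≤ n) (hg : IsContinuousSpacetime g X)
    (he : IsSmoothChart e) (hO : O ∈ e.source) (hM : IsOpen M) (hOM : O ∉ M)
    (hI : M = timelikeFuture g X O univ)
    (hu : ContMDiffOn (𝓡 (n + 1)) (𝓡 (n + 1)).tangent ∞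
      (fun x => (⟨x, u x⟩ : TangentBundle (𝓡 (n + 1)) N)) M)
    (hend : ∀ (γ : ℝ → N) (J : Set ℝ), IsMaximalIntegralCurveIn u M γ J →
      Tendsto (fun t : J => γ t) atBot (𝓝 O))
    {U : Coord n} (hQ : chartForm g e O U U < 0)
    (hL : chartForm g e O (chartVec e O (X O)) U < 0) :
    ¬ Tendsto (fun x => chartVec e x (u x)) (𝓝[M] O) (𝓝 U) := by
  intro hU
  obtain ⟨κ, hκ, hQκ⟩ : ∃ κ > 0, chartForm g e O U U < -κ :=
    ⟨-chartForm g e O U U / 2, by linarith, by linarith⟩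
  have hU0 : 0 < ‖U‖ := by
    rw [norm_pos_iff]
    rintro rfl
    simp [chartForm] at hQ
  -- directions close to `U` are timelike near `O`
  have hfst : Tendsto Prod.fst (𝓝 O ×ˢ 𝓝 U) (𝓝 O) := tendsto_fst
  have hsnd : Tendsto Prod.snd (𝓝 O ×ˢ 𝓝 U) (𝓝 U) := tendsto_snd
  have hev := ((hg.tendsto_chartForm he hO hfst hsnd hsnd).eventually_lt_const hQκ).and
    ((hg.tendsto_chartForm he hO hfst
      (((continuousOn_chartVec he hg.continuous_orientation).continuousAt
        (e.open_source.mem_nhds hO)).tendsto.comp hfst) hsnd).eventually_lt_const hL)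
  obtain ⟨pa, hpa, pb, hpb, hab⟩ := eventually_prod_iff.1 hev
  obtain ⟨δ, hδ, hδb⟩ := Metric.eventually_nhds_iff_ball.1 hpb
  obtain ⟨v, hvU, d, hd, hvd⟩ := exists_near_not_parallel (by simp; omega) U hδ
  -- If the flow line reaches `O`, the first two bounds control its duration `T` and then the drift
  -- `ε T` in terms of `s d`. If it leaves the ball, the third keeps the drift within half of the
  -- tolerance `δ`.
  obtain ⟨ε, hε, hεU, hεd, hεδ⟩ : ∃ ε > 0, ε ≤ ‖U‖ / 2 ∧ ε * (6 * (‖v‖ + 1)) ≤ d * ‖U‖ ∧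
      ε ≤ δ / 2 := by
    refine ⟨min (‖U‖ / 2) (min (d * ‖U‖ / (6 * (‖v‖ + 1))) (δ / 2)), by positivity,
      min_le_left _ _, ?_, (min_le_right _ _).trans (min_le_right _ _)⟩
    rw [← le_div_iff₀ (by positivity)]
    exact (min_le_right _ _).trans (min_le_left _ _)
  -- a coordinate ball on which `u` is close to `U`
  obtain ⟨r, hr, hball⟩ : ∃ r > 0, ∀ y ∈ Metric.closedBall (e O) r, y ∈ e.target ∧
      pa (e.symm y) ∧ (e.symm y ∈ M →
        ‖chartVec e (e.symm y) (u (e.symm y)) - U‖ ≤ ε) := by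
    have h1 : ∀ᶠ x in 𝓝 O, x ∈ M → ‖chartVec e x (u x) - U‖ ≤ ε := by
      have := hU.eventually (Metric.closedBall_mem_nhds U hε)
      rw [eventually_nhdsWithin_iff] at this
      exact this.mono fun x hx hxM => mem_closedBall_iff_norm.1 (hx hxM)
    have h2 : Tendsto e.symm (𝓝 (e O)) (𝓝 O) := by
      have := (e.continuousAt_symm (e.map_source hO)).tendsto
      rwa [e.left_inv hO] at this
    have h3 := (e.open_target.eventually_mem (e.map_source hO)).and (h2.eventually (hpa.and h1))
    exact Metric.nhds_basis_closedBall.eventually_iff.1 h3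
  have hC : ∀ y ∈ Metric.closedBall (e O) r, y ∈ e.target ∧ ∀ w, ‖w - U‖ < δ →
      chartForm g e (e.symm y) w w < -κ ∧
      chartForm g e (e.symm y) (chartVec e (e.symm y) (X (e.symm y))) w < 0 := fun y hy =>
    ⟨(hball y hy).1, fun w hw => hab (hball y hy).2.1 (hδb w (mem_ball_iff_norm.2 hw))⟩
  -- a point of `M` in direction `v`
  obtain ⟨s, hs, hsr, hsδ⟩ : ∃ s > 0, s * ‖v‖ < r ∧
      s * ‖v‖ * (‖U‖ + ε) < δ / 2 * (r - s * ‖v‖) := by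
    have h1 : Tendsto (fun s : ℝ => s * ‖v‖) (𝓝[>] 0) (𝓝 (0 * ‖v‖)) :=
      ((continuous_id.mul continuous_const).tendsto 0).mono_left nhdsWithin_le_nhds
    rw [zero_mul] at h1
    have h2 := h1.eventually_lt_const hr
    have h3 := (h1.mul_const (‖U‖ + ε)).eventually_lt ((h1.const_sub r).const_mul (δ / 2))
      (by rw [zero_mul, sub_zero]; positivity)
    obtain ⟨s, h4, h5, h6⟩ := (h2.and (h3.and self_mem_nhdsWithin)).exists
    exact ⟨s, h6, h4, h5⟩
  have hOball : e O ∈ Metric.closedBall (e O) r := Metric.mem_closedBall_self hr.le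
  have hvball : e O + s • v ∈ Metric.ball (e O) r := by
    rw [mem_ball_iff_norm, add_sub_cancel_left, norm_smul, Real.norm_of_nonneg hs.le]
    exact hsr
  have hvt : e O + s • v ∈ e.target := (hC _ (Metric.ball_subset_closedBall hvball)).1
  have hq : e.symm (e O + s • v) ∈ M := by
    rw [hI]
    refine ⟨_, 0, 0 + s, isTimelikeCurve_segment_of_closedBall he hκ hC hs hvU hOball
      (Metric.ball_subset_closedBall hvball) 0, mapsTo_univ _ _, ?_, ?_⟩
    · simp [e.left_inv hO]
    · simp
  obtain ⟨γ, J, hγmax, h0J, hγ0⟩ := exists_isMaximalIntegralCurveIn hM hu hq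
  obtain ⟨hJo, hJn, hJc, hJM, hγJ⟩ := hγmax.1
  have heγ0 : e (γ 0) = e O + s • v := by rw [hγ0, e.right_inv hvt]
  -- as long as the curve stays in the ball, it is almost straight
  have hK : ∀ t, γ t ∈ e.symm '' Metric.closedBall (e O) r →
      γ t ∈ e.source ∧ e (γ t) ∈ Metric.closedBall (e O) r := by
    rintro t ⟨y, hy, hyt⟩
    rw [← hyt, e.right_inv (hC y hy).1]
    exact ⟨e.map_target (hC y hy).1, hy⟩
  have hest : ∀ t ∈ J, t ≤ 0 → (∀ t' ∈ Icc t 0, γ t' ∈ e.symm '' Metric.closedBall (e O) r) →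
      ‖e O + s • v - e (γ t) - (-t) • U‖ ≤ ε * -t := by
    intro t ht ht0 hin
    have hsub : Icc t 0 ⊆ J := hJc.out ht h0J
    have h1 := norm_chart_sub_le_of_integralCurve he (U := U) (ε := ε) ht0 (hγJ.mono hsub)
      (fun t' ht' => (hK t' (hin t' ht')).1) (fun t' ht' => by
        obtain ⟨y, hy, hyt⟩ := hin t' ht'
        have h2 := (hball y hy).2.2
        rw [hyt] at h2
        exact h2 (hJM (hsub ht')))
    rwa [heγ0, zero_sub] at h1
  by_cases hexit : ∃ t ∈ J, t ≤ 0 ∧ γ t ∉ e.source ∩ e ⁻¹' Metric.ball (e O) r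
  · -- the curve leaves the ball in the past of `O`
    obtain ⟨t₂, ht₂, ht₂0, hout⟩ := hexit
    have hBo : IsOpen (e.source ∩ e ⁻¹' Metric.ball (e O) r) :=
      e.isOpen_inter_preimage Metric.isOpen_ball
    have hsub : Icc t₂ 0 ⊆ J := hJc.out ht₂ h0J
    have hcont : ContinuousOn γ (Icc t₂ 0) := (hγJ.mono hsub).continuousOn
    have hcomp : IsCompact (Icc t₂ 0 ∩ γ ⁻¹' (e.source ∩ e ⁻¹' Metric.ball (e O) r)ᶜ) :=
      isCompact_Icc.of_isClosed_subset
        (hcont.preimage_isClosed_of_isClosed isClosed_Icc hBo.isClosed_compl) inter_subset_left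
    -- Backwards from `0`, `t₁` is the first parameter at which the curve is outside the open ball.
    obtain ⟨t₁, ⟨ht₁, ht₁out⟩, hmax⟩ := hcomp.exists_isGreatest ⟨t₂, ⟨le_rfl, ht₂0⟩, hout⟩
    -- Being compact in a Hausdorff space, the closed coordinate ball is closed in `N`; hence the
    -- exit point is still in the chart, on the boundary sphere.
    have hKclosed : IsClosed (e.symm '' Metric.closedBall (e O) r) :=
      ((isCompact_closedBall _ _).image_of_continuousOn
        (e.continuousOn_symm.mono fun y hy => (hC y hy).1)).isClosed
    have ht₁0 : t₁ < 0 := by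
      refine lt_of_le_of_ne ht₁.2 fun h => ht₁out ?_
      rw [h, mem_inter_iff, mem_preimage, heγ0, hγ0]
      exact ⟨e.map_target hvt, hvball⟩
    have hin' : ∀ t ∈ Ioc t₁ 0, γ t ∈ e.symm '' Metric.closedBall (e O) r := by
      intro t ht
      by_contra hcon
      refine absurd (hmax ⟨⟨ht₁.1.trans ht.1.le, ht.2⟩, fun h => hcon ?_⟩) (not_le.2 ht.1)
      exact ⟨e (γ t), Metric.ball_subset_closedBall h.2, e.left_inv h.1⟩
    have hin : ∀ t ∈ Icc t₁ 0, γ t ∈ e.symm '' Metric.closedBall (e O) r := by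
      intro t ht
      rcases ht.1.eq_or_lt with rfl | h
      · have h1 : Tendsto γ (𝓝[Ioc t₁ 0] t₁) (𝓝 (γ t₁)) :=
          (hcont t₁ ht₁).mono fun x hx => ⟨ht₁.1.trans hx.1.le, hx.2⟩
        have : NeBot (𝓝[Ioc t₁ 0] t₁) := by
          rw [nhdsWithin_Ioc_eq_nhdsGT ht₁0]; infer_instance
        exact hKclosed.mem_of_tendsto h1 (eventually_of_mem self_mem_nhdsWithin hin')
      · exact hin' t ⟨h, ht.2⟩
    obtain ⟨hsrc, hzball⟩ := hK t₁ (hin t₁ ⟨le_rfl, ht₁0.le⟩)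
    have hnorm : r ≤ ‖e O - e (γ t₁)‖ := by
      by_contra! h
      exact ht₁out ⟨hsrc, by rwa [mem_preimage, mem_ball_iff_norm']⟩
    have h1 := hest t₁ (hsub ht₁) ht₁0.le hin
    set T := -t₁ with hT_def
    have hT : 0 < T := by linarith
    have hsv : ‖s • v‖ = s * ‖v‖ := by rw [norm_smul, Real.norm_of_nonneg hs.le]
    have hTlow : r - s * ‖v‖ ≤ T * (‖U‖ + ε) := by
      have h2 : e O - e (γ t₁) = (e O + s • v - e (γ t₁) - T • U) + T • U - s • v := by module
      have h3 : ‖e O - e (γ t₁)‖ ≤ ε * T + T * ‖U‖ + s * ‖v‖ := by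
        rw [h2]
        refine (norm_sub_le _ _).trans (add_le_add ((norm_add_le _ _).trans (add_le_add h1 ?_)) ?_)
        · rw [norm_smul, Real.norm_of_nonneg hT.le]
        · exact hsv.le
      linarith
    -- Leaving the ball takes at least the time `(r - s‖v‖) / (‖U‖ + ε)`, and `s` was chosen small
    -- against it.
    have hsT : s * ‖v‖ < δ / 2 * T := by
      have h2 : s * ‖v‖ * (‖U‖ + ε) < δ / 2 * T * (‖U‖ + ε) := by
        refine hsδ.trans_le ?_
        rw [mul_assoc]
        exact mul_le_mul_of_nonneg_left hTlow (by positivity)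
      exact lt_of_mul_lt_mul_right h2 (by positivity)
    -- The drift `ε T` and the offset `s‖v‖` each cost at most `δ T / 2`, the latter strictly less.
    have hw : ‖T⁻¹ • (e O - e (γ t₁)) - U‖ < δ := by
      have h2 : T⁻¹ • (e O - e (γ t₁)) - U =
          T⁻¹ • ((e O + s • v - e (γ t₁) - T • U) - s • v) := by
        have h3 : U = T⁻¹ • T • U := by rw [smul_smul, inv_mul_cancel₀ hT.ne', one_smul]
        conv_lhs => rw [h3]
        module
      rw [h2, norm_smul, norm_inv, Real.norm_of_nonneg hT.le, inv_mul_lt_iff₀ hT]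
      have h3 := norm_sub_le (e O + s • v - e (γ t₁) - T • U) (s • v)
      nlinarith
    have hend' : e (γ t₁) + T • T⁻¹ • (e O - e (γ t₁)) = e O := by
      rw [smul_smul, mul_inv_cancel₀ hT.ne', one_smul, add_sub_cancel]
    -- A timelike curve from `O` to the exit point, followed by the segment back to `O`, is a closed
    -- timelike curve.
    have hz : γ t₁ ∈ timelikeFuture g X O univ := hI ▸ hJM (hsub ht₁)
    obtain ⟨γ₁, a, b, hγ₁, -, hγ₁a, hγ₁b⟩ := hz
    have hγ₂ := isTimelikeCurve_segment_of_closedBall he hκ hC hT hw hzball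
      (by rw [hend']; exact hOball) b
    have hcat := hγ₁.concat hγ₂ (by simp [hγ₁b, e.left_inv hsrc])
    refine hOM ?_
    rw [hI]
    refine ⟨_, _, _, hcat, mapsTo_univ _ _, ?_, ?_⟩
    · simp [hγ₁.1.le, hγ₁a]
    · simp only [add_le_iff_nonpos_right, not_le.2 hT, if_false, add_sub_cancel_left]
      rw [hend', e.left_inv hO]
  · -- the curve reaches `O` in the ball
    push Not at hexit
    have hτ : 0 < s * d / 6 := by positivity
    have hnear : e.source ∩ e ⁻¹' Metric.ball (e O) (s * d / 6) ∈ 𝓝 O :=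
      (e.isOpen_inter_preimage Metric.isOpen_ball).mem_nhds ⟨hO, Metric.mem_ball_self hτ⟩
    have : Nonempty J := ⟨⟨0, h0J⟩⟩
    obtain ⟨⟨t, htJ⟩, hnt, ht0⟩ :=
      (((hend γ J hγmax).eventually hnear).and (eventually_le_atBot ⟨0, h0J⟩)).exists
    have ht0' : t ≤ 0 := ht0
    have h1 := hest t htJ ht0' fun t' ht' => by
      have h2 := hexit t' (hJc.out htJ h0J ht') ht'.2
      exact ⟨e (γ t'), Metric.ball_subset_closedBall h2.2, e.left_inv h2.1⟩
    have hdist : ‖e O - e (γ t)‖ ≤ s * d / 6 := (mem_ball_iff_norm'.1 hnt.2).le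
    set T := -t with hT_def
    have hT : 0 ≤ T := by linarith
    have hsv : ‖s • v - T • U‖ ≤ ε * T + s * d / 6 := by
      have h2 : s • v - T • U = (e O + s • v - e (γ t) - T • U) - (e O - e (γ t)) := by module
      rw [h2]
      exact (norm_sub_le _ _).trans (add_le_add h1 hdist)
    have hlow : s * d ≤ ‖s • v - T • U‖ := by
      have h2 : s • v - T • U = s • (v - (T / s) • U) := by
        rw [smul_sub, smul_smul, mul_div_cancel₀ _ hs.ne']
      rw [h2, norm_smul, Real.norm_of_nonneg hs.le]
      exact mul_le_mul_of_nonneg_left (hvd _) hs.le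
    have hTU : T * ‖U‖ ≤ s * ‖v‖ + (ε * T + s * d / 6) := by
      have h2 : T • U = s • v - (s • v - T • U) := by module
      have h3 := norm_sub_le (s • v) (s • v - T • U)
      rw [← h2, norm_smul, norm_smul, Real.norm_of_nonneg hT, Real.norm_of_nonneg hs.le] at h3
      linarith
    have h2 : T * ‖U‖ ≤ 2 * (s * ‖v‖ + s * d / 6) := by nlinarith
    have h3 : ε * T * ‖U‖ ≤ s * d / 3 * ‖U‖ + ‖U‖ * (s * d / 6) := by
      have h4 : ε * (T * ‖U‖) ≤ ε * (2 * (s * ‖v‖ + s * d / 6)) :=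
        mul_le_mul_of_nonneg_left h2 hε.le
      have h5 : s * (ε * (6 * (‖v‖ + 1))) ≤ s * (d * ‖U‖) := mul_le_mul_of_nonneg_left hεd hs.le
      have h6 : ε * (s * d / 6) ≤ ‖U‖ / 2 * (s * d / 6) := mul_le_mul_of_nonneg_right hεU hτ.le
      have h7 : 0 < s * ε := by positivity
      nlinarith
    -- With the end error `s d / 6`, the vector `s v` is within `2 s d / 3` of `T U`, yet its
    -- distance to the line of `U` is at least `s d`.
    have h4 : ε * T ≤ s * d / 3 + s * d / 6 := by
      refine le_of_mul_le_mul_right ?_ hU0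
      linarith
    linarith

/-- The continuous extensions of energy density and pressure add up to zero at a common past
endpoint of all flow lines. -/
theorem IsPerfectFluidSolution.add_eq_zero [T2Space N] (hn : 2 ≤ n)
    (hg : IsContinuousSpacetime g X) (hM : IsOpen M) (hOM : O ∈ closure M \ M)
    (hI : M = timelikeFuture g X O univ) {ρ p ρ' p' : N → ℝ}
    (ha : IsPerfectFluidSolution g X M u ρ p) (hb : HasPastEndpoint g X M u O)
    (hric : TensorExtends (ricci g) M O) (hρ : IsContExt M O ρ ρ') (hp : IsContExt M O p p') :
    ρ' O + p' O = 0 := by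
  by_contra hc
  obtain ⟨e, he, hO, hric⟩ := hric
  have : NeBot (𝓝[M] O) := mem_closure_iff_nhdsWithin_neBot.1 hOM.1
  have hlimρ : Tendsto ρ (𝓝[M] O) (𝓝 (ρ' O)) := hρ.tendsto
  have hlimp : Tendsto p (𝓝[M] O) (𝓝 (p' O)) := hp.tendsto
  have hev : ∀ᶠ x in 𝓝[M] O, x ∈ e.source ∧ x ∈ M :=
    (eventually_of_mem (nhdsWithin_le_nhds (e.open_source.mem_nhds hO)) fun _ h => h).and
      (eventually_of_mem self_mem_nhdsWithin fun _ h => h)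
  have hlim : ∀ i j, ∃ A, Tendsto (fun x =>
      (compMatrix g e (e x)).mulVec (chartVec e x (u x)) i *
        (compMatrix g e (e x)).mulVec (chartVec e x (u x)) j) (𝓝[M] O) (𝓝 A) := by
    intro i j
    obtain ⟨f, hf⟩ := hric i j
    have h1 : Tendsto (fun x => comp (ricci g) e i j (e x)) (𝓝[M] O) (𝓝 (f O)) := by
      have h2 := hf.tendsto
      rwa [inter_comm, nhdsWithin_inter_of_mem'
        (mem_nhdsWithin_of_mem_nhds (e.open_source.mem_nhds hO))] at h2
    have h2 : Tendsto (fun x => compMatrix g e (e x) i j) (𝓝[M] O) (𝓝 (comp g e i j (e O))) :=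
      (hg.tendsto_comp he hO i j).mono_left nhdsWithin_le_nhds
    -- This is the coefficient `R / 2 + 8π p` of the metric, with `R` eliminated by the trace so
    -- that its limit is known.
    have h3 : Tendsto (fun x => 1 / 2 * (16 * Real.pi / ((n : ℝ) - 1) * (ρ x - n * p x)) +
        8 * Real.pi * p x) (𝓝[M] O) (𝓝 (1 / 2 * (16 * Real.pi / ((n : ℝ) - 1) *
          (ρ' O - n * p' O)) + 8 * Real.pi * p' O)) :=
      (((hlimρ.sub (hlimp.const_mul _)).const_mul _).const_mul _).add (hlimp.const_mul _)
    have h4 := (hlimρ.add hlimp).const_mul (8 * Real.pi)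
    have h5 : 8 * Real.pi * (ρ' O + p' O) ≠ 0 := mul_ne_zero (by positivity) hc
    refine ⟨_, ((h1.sub (h3.mul h2)).div h4 h5).congr' ?_⟩
    filter_upwards [hev, h4.eventually_ne h5] with x hx hx0
    rw [Pi.div_apply, div_eq_iff hx0, ha.comp_ricci_eq hg.lorentz he hx.1 hx.2,
      ha.scalarCurvature_eq hn hg.lorentz hx.2]
    ring
  obtain ⟨U, hU, hUU, hXU⟩ := hg.exists_tendsto_chartVec he hO ha.unit ha.future hlim
  exact not_tendsto_chartVec (by omega) hg he hO hM hOM.2 hI ha.smooth_u hb.tendsto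
    (by rw [hUU]; norm_num) hXU hU

end PastEndpoint

end C0Spacetime

end

/-! ### The scalar curvature at the past endpoint. -/

theorem corollary2p4 (n : ℕ) (hn : 2 ≤ n)
    {N : Type*} [TopologicalSpace N] [T2Space N] [SecondCountableTopology N]
    [ChartedSpace (Coord n) N] [IsManifold (𝓡 (n + 1)) ∞ N]
    (g : Tensor2 n N) (X : VecField n N) (M : Set N) (hM : IsContinuousExtension g X M)
    (O : N) (hO : O ∈ pastBoundary g X M) (hI : M = timelikeFuture g X O univ)
    (u : VecField n N) (ρ p : N → ℝ)
    (ha : IsPerfectFluidSolution g X M u ρ p)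
    (hb : HasPastEndpoint g X M u O)
    (hc : TensorExtends (ricci g) M O ∧ (∃ ρ', IsContExt M O ρ ρ') ∧ ∃ p', IsContExt M O p p')
    (hd : IsStronglyCausalAt g X O ∨ PastBoundaryLocallyInFuture g X M O) :
    (∃ R', IsContExt M O (scalarCurvature g) R') ∧
    ∀ R' ρ' : N → ℝ, IsContExt M O (scalarCurvature g) R' → IsContExt M O ρ ρ' →
      R' O = 16 * Real.pi * (((n : ℝ) + 1) / ((n : ℝ) - 1)) * ρ' O ∧
      (n + 1 = 4 → R' O = 32 * Real.pi * ρ' O) := by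
  obtain ⟨hric, ⟨ρ₀, hρ₀⟩, ⟨p₀, hp₀⟩⟩ := hc
  have hR : ∀ x ∈ M, 16 * Real.pi / ((n : ℝ) - 1) * (ρ x - n * p x) = scalarCurvature g x :=
    fun x hx => (ha.scalarCurvature_eq hn hM.spacetime.lorentz hx).symm
  have : NeBot (𝓝[M] O) := mem_closure_iff_nhdsWithin_neBot.1 hO.1.1
  refine ⟨⟨fun x => 16 * Real.pi / ((n : ℝ) - 1) * (ρ₀ x - n * p₀ x), ?_, fun x hx => ?_⟩,
    fun R' ρ' hR' hρ' => ?_⟩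
  · exact continuousOn_const.mul (hρ₀.1.sub (continuousOn_const.mul hp₀.1))
  · simp only [hρ₀.2 hx, hp₀.2 hx, hR x hx]
  · have hsum := ha.add_eq_zero hn hM.spacetime hM.isOpen hO.1 hI hb hric hρ' hp₀
    have hlim := ((hρ'.tendsto.sub (hp₀.tendsto.const_mul (n : ℝ))).const_mul
      (16 * Real.pi / ((n : ℝ) - 1))).congr' (eventually_of_mem self_mem_nhdsWithin hR)
    -- `O` is a limit point of `M`, so the value of any continuous extension there is forced by the
    -- trace formula on `M`.
    have hRO := tendsto_nhds_unique hR'.tendsto hlim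
    have hp : p₀ O = -ρ' O := by linarith
    have hmain : R' O = 16 * Real.pi * (((n : ℝ) + 1) / ((n : ℝ) - 1)) * ρ' O := by
      rw [hRO, hp]
      ring
    refine ⟨hmain, fun h4 => ?_⟩
    have hn3 : (n : ℝ) = 3 := by exact_mod_cast (show n = 3 by omega)
    rw [hmain, hn3]
    ring
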